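/- **Setting.** Let $\mathcal H$ be a complex Hilbert space with unit sphere $S_{\mathcal H}$, let $\mathcal D_A\subset\mathcal H$ be a dense subspace, and let $H_0,H_1,\dots,H_r$ $(r\ge 0)$ be time-independent linear operators $\mathcal D_A\to\mathcal D_A$ that are skew-Hermitian: $\langle H_i x,y\rangle=-\langle x,H_i y\rangle$ for $x,y\in\mathcal D_A$. For a set $V$ of operators on $\mathcal D_A$ let $\mathcal L(V)$ denote the real Lie algebra generated by $V$ under the commutator, and put $L=\mathcal L\{H_0,\dots,H_r\}$. For a Lie algebra $K$ of operators on $\mathcal D_A$ and $\psi\in\mathcal D_A$ write $K\psi=\{X\psi: X\in K\}$. Assume that $\mathcal D_A$ is an *analytic domain* for $H_0,\dots,H_r$, that is: * every $\omega\in\mathcal D_A$ is an analytic vector for $L$: for some $s>0$ and some finite linear basis $b_1,\dots,b_d$ of $L$ one has $\sum_{n\ge0}\frac{s^n}{n!}\sum_{1\le i_1,\dots,i_n\le d}\|b_{i_1}\cdots b_{i_n}\omega\|<\infty$ (in particular $L$ is finite-dimensional); * for every $X\in L$ there is a strongly continuous one-parameter group $(U_t)_{t\in\mathbb R}$ of unitary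 operators on $\mathcal H$ with $U_t\mathcal D_A\subset\mathcal D_A$ for all $t$ and such that, for each $\psi\in\mathcal D_A$, $U_t\psi=\sum_{n\ge 0}\frac{t^n}{n!}X^n\psi$ for all sufficiently small $|t|$. Consider the control system $$\dot\psi(t)=\Big[H_0+\sum_{l=1}^r u_l(t)H_l\Big]\psi(t),\qquad \psi(t_0)=\psi_0, \tag{1}$$ with piecewise-constant real controls $u_1,\dots,u_r$ having finitely many switches on bounded intervals. Its solutions are continuous curves in $\mathcal D_A$ that satisfy (1) between the switching times. Let $M\subset S_{\mathcal H}$ be a connected embedded $C^\infty$ submanifold of dimension $m<\infty$ (with the topology inherited from $\mathcal H$) such that * $M\cap\mathcal D_A$ is dense in $M$, and the tangent space of $M$ at each $\psi\in M\cap\mathcal D_A$ is $L\psi$; * every solution of (1) that starts in $M\cap\mathcal D_A$ stays in $M$ at all later times. For $t>t_0$ let $R_t(\psi)$ be the set of all states $\psi(t)$ of solutions of (1), over all controls as above, with $\psi(t_0)=\psi$ and $\psi(s)\in M\cap\mathcal D_A$ for $t_0\le s\le t$. The system is *strongly analytically controllable* on $M$ if $R_t(\psi)=M\cap\mathcal D_A$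 for all $t>t_0$ and all $\psi\in M\cap\mathcal D_A$. **Corollary.** Let $$\mathcal B=\mathcal L\{H_1,\dots,H_r\},\qquad \mathcal C=\mathcal L\{\mathcal B,\mathrm{ad}_{H_0}\mathcal B,\mathrm{ad}_{H_0}^2\mathcal B,\dots\}.$$ If $\dim_{\mathbb R}\mathcal C\psi=m$ for all $\psi\in M\cap\mathcal D_A$ and $[\mathcal B,\mathcal C]\subset\mathcal B$, then the time-invariant system (1) is strongly analytically controllable on $M$. -/

import Mathlib

open scoped ContDiff

/- Operators carry the commutator as their Lie bracket. -/
attribute [local instance 100] LieRing.ofAssociativeRing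

noncomputable section

namespace QuantumControl

/-! ### Finite-dimensional submanifolds of a Hilbert space -/

section Manifold

variable {𝓗 : Type*} [NormedAddCommGroup 𝓗] [NormedSpace ℝ 𝓗]

/-- `φ`, restricted to the open set `V ⊆ ℝᵐ`, is a smooth local parametrization of the set
`M ⊆ 𝓗`: a smooth immersion that is a homeomorphism of `V` onto a relatively open part of `M`
(where `M` carries the topology inherited from `𝓗`). -/
structure IsLocalParam (m : ℕ) (M : Set 𝓗) (V : Set (EuclideanSpace ℝ (Fin m)))
    (φ : EuclideanSpace ℝ (Fin m) → 𝓗) : Prop where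
  isOpen : IsOpen V
  smooth : ContDiffOn ℝ ∞ φ V
  immersion : ∀ v ∈ V, Function.Injective (fderiv ℝ φ v)
  embedding : Topology.IsEmbedding (V.domRestrict φ)
  image_eq : ∃ U : Set 𝓗, IsOpen U ∧ φ '' V = M ∩ U

/-- `M` is an embedded smooth submanifold of `𝓗` of dimension `m`. -/
def IsEmbeddedSubmanifold (m : ℕ) (M : Set 𝓗) : Prop :=
  ∀ p ∈ M, ∃ V φ, IsLocalParam m M V φ ∧ p ∈ φ '' V

/-- `T` is the tangent space of the `m`-dimensional submanifold `M` at `p`: the range of the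
differential of a local parametrization of `M` around `p`. (It does not depend on the
parametrization.) -/
def HasTangentSpaceAt (m : ℕ) (M : Set 𝓗) (p : 𝓗) (T : Submodule ℝ 𝓗) : Prop :=
  ∃ V φ, IsLocalParam m M V φ ∧
    ∃ v ∈ V, φ v = p ∧ T = LinearMap.range (fderiv ℝ φ v : EuclideanSpace ℝ (Fin m) →ₗ[ℝ] 𝓗)

end Manifold

variable {𝓗 : Type*} [NormedAddCommGroup 𝓗] [InnerProductSpace ℂ 𝓗]
variable {D : Submodule ℂ 𝓗} {r : ℕ}

/-! ### Lie algebras of operators on the common invariant domain `D`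

All Lie algebras are real Lie algebras of linear operators `D → D`, with the commutator as
bracket. `H₀` is the drift operator, `Hc l` (`l : Fin r`) are the control operators. -/

/-- `𝓛 {H₀, H₁, …, H_r}`. -/
def lieL (H₀ : Module.End ℂ D) (Hc : Fin r → Module.End ℂ D) :
    LieSubalgebra ℝ (Module.End ℂ D) :=
  LieSubalgebra.lieSpan ℝ (Module.End ℂ D) (insert H₀ (Set.range Hc))

/-- `𝓑 = 𝓛 {H₁, …, H_r}`. -/
def lieB (Hc : Fin r → Module.End ℂ D) : LieSubalgebra ℝ (Module.End ℂ D) :=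
  LieSubalgebra.lieSpan ℝ (Module.End ℂ D) (Set.range Hc)

/-- `𝓒 = 𝓛 {𝓑, ad_{H₀} 𝓑, ad²_{H₀} 𝓑, …}`. -/
def lieC (H₀ : Module.End ℂ D) (Hc : Fin r → Module.End ℂ D) :
    LieSubalgebra ℝ (Module.End ℂ D) :=
  LieSubalgebra.lieSpan ℝ (Module.End ℂ D)
    (⋃ n : ℕ, (fun X => (LieAlgebra.ad ℝ (Module.End ℂ D) H₀ ^ n) X) ''
      (lieB Hc : Set (Module.End ℂ D)))

/-- Evaluation of operators at a state `ψ ∈ D`, as a real linear map `X ↦ X ψ`. -/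
def evalAt (ψ : D) : Module.End ℂ D →ₗ[ℝ] 𝓗 where
  toFun X := (X ψ : 𝓗)
  map_add' _ _ := rfl
  map_smul' _ _ := rfl

/-- `K ψ = {X ψ | X ∈ K}`, a real linear subspace of the Hilbert space. -/
def orbitSpace (K : LieSubalgebra ℝ (Module.End ℂ D)) (ψ : D) : Submodule ℝ 𝓗 :=
  K.toSubmodule.map (evalAt ψ)

/-! ### Analytic vectors and analytic domains -/

/-- `X` is skew-Hermitian on `D`. -/
def IsSkewHermitian (X : Module.End ℂ D) : Prop :=
  ∀ x y : D, inner ℂ (X x : 𝓗) (y : 𝓗) = - inner ℂ (x : 𝓗) (X y : 𝓗)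

/-- `w` is an analytic vector for the whole Lie algebra `L`: for some `s > 0` and some (finite)
linear basis `b₁, …, b_d` of `L`, the series
`∑ₙ (1/n!) ∑_{1 ≤ i₁, …, iₙ ≤ d} ‖b_{i₁} ⋯ b_{iₙ} w‖ sⁿ` converges. -/
def IsAnalyticVector (L : LieSubalgebra ℝ (Module.End ℂ D)) (w : D) : Prop :=
  ∃ (d : ℕ) (b : Module.Basis (Fin d) ℝ L) (s : ℝ), 0 < s ∧
    Summable fun n : ℕ => (1 / (n.factorial : ℝ)) *
      (∑ i : Fin n → Fin d,
        ‖(((List.ofFn fun k => (b (i k) : Module.End ℂ D)).prod w : D) : 𝓗)‖) * s ^ n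

/-- `U` is the one-parameter unitary group `t ↦ exp (t X)`: a strongly continuous unitary group,
defined for all times, which leaves `D` invariant and is given on `D` by the exponential series
for small times. -/
structure IsExponentialGroup (X : Module.End ℂ D) (U : ℝ → (𝓗 ≃ₗᵢ[ℂ] 𝓗)) : Prop where
  map_add : ∀ s t x, U (s + t) x = U s (U t x)
  continuous : ∀ x, Continuous fun t => U t x
  invariant : ∀ t, ∀ x ∈ D, U t x ∈ D
  local_exp : ∀ x : D, ∃ s > 0, ∀ t : ℝ, |t| < s →
    HasSum (fun n : ℕ => (t ^ n / (n.factorial : ℝ)) • (((X ^ n) x : D) : 𝓗)) (U t x)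

/-- `D` is an analytic domain for the operators `H₀, H₁, …, H_r`: it is a common dense
invariant domain (invariance is built into the type of the operators), it consists of analytic
vectors for `L = 𝓛 {H₀, …, H_r}`, and every `X ∈ L` exponentiates to a globally defined
one-parameter unitary group leaving `D` invariant. These one-parameter groups generate the
unitary Lie group with Lie algebra `L`. -/
structure IsAnalyticDomain (D : Submodule ℂ 𝓗) (H₀ : Module.End ℂ D)
    (Hc : Fin r → Module.End ℂ D) : Prop where
  dense : Dense (D : Set 𝓗)
  analytic : ∀ w : D, IsAnalyticVector (lieL H₀ Hc) w
  exponentiates : ∀ X ∈ lieL H₀ Hc, ∃ U : ℝ → (𝓗 ≃ₗᵢ[ℂ] 𝓗), IsExponentialGroup X U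

/-! ### The control system -/

/-- On the time interval `[t₀, t₁]`, the control `u` is piecewise constant and the continuous
curve `ψ` in `D` solves `ψ' = [H₀ + ∑ₗ uₗ(t) Hₗ] ψ` between the switching times `τ k`. -/
def IsSolution (H₀ : Module.End ℂ D) (Hc : Fin r → Module.End ℂ D) (t₀ t₁ : ℝ)
    (u : ℝ → Fin r → ℝ) (ψ : ℝ → D) : Prop :=
  ContinuousOn ψ (Set.Icc t₀ t₁) ∧
  ∃ (n : ℕ) (τ : ℕ → ℝ) (c : ℕ → Fin r → ℝ), Monotone τ ∧ τ 0 = t₀ ∧ τ n = t₁ ∧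
    ∀ k < n, (∀ t ∈ Set.Ico (τ k) (τ (k + 1)), u t = c k) ∧
      ∀ t ∈ Set.Ioo (τ k) (τ (k + 1)),
        HasDerivAt (fun s => (ψ s : 𝓗)) (((H₀ + ∑ l, u t l • Hc l) (ψ t) : D) : 𝓗) t

/-- The states `χ` that can be reached at time `t₁` from the state `ψ₀` at time `t₀`, along a
solution that stays in `M ∩ D`. -/
def reachableSet (H₀ : Module.End ℂ D) (Hc : Fin r → Module.End ℂ D) (M : Set 𝓗)
    (t₀ t₁ : ℝ) (ψ₀ : 𝓗) : Set 𝓗 :=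
  {χ | ∃ (u : ℝ → Fin r → ℝ) (ψ : ℝ → D), IsSolution H₀ Hc t₀ t₁ u ψ ∧
    (∀ t ∈ Set.Icc t₀ t₁, (ψ t : 𝓗) ∈ M) ∧ (ψ t₀ : 𝓗) = ψ₀ ∧ (ψ t₁ : 𝓗) = χ}

/-- The state space of the control system: a connected embedded `m`-dimensional submanifold `M`
of the unit sphere in which `M ∩ D` is dense, whose tangent space at each `ψ ∈ M ∩ D` is
`𝓛 {H₀, …, H_r} ψ`, and which no solution starting in `M ∩ D` leaves. -/
structure IsStateManifold (H₀ : Module.End ℂ D) (Hc : Fin r → Module.End ℂ D)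
    (m : ℕ) (M : Set 𝓗) : Prop where
  subset_sphere : M ⊆ Metric.sphere 0 1
  submanifold : IsEmbeddedSubmanifold m M
  connected : IsConnected M
  dense : M ⊆ closure (M ∩ D)
  tangent : ∀ ψ : D, (ψ : 𝓗) ∈ M → HasTangentSpaceAt m M (ψ : 𝓗) (orbitSpace (lieL H₀ Hc) ψ)
  invariant : ∀ (t₀ t₁ : ℝ) (u : ℝ → Fin r → ℝ) (ψ : ℝ → D),
    IsSolution H₀ Hc t₀ t₁ u ψ → (ψ t₀ : 𝓗) ∈ M → ∀ t ∈ Set.Icc t₀ t₁, (ψ t : 𝓗) ∈ M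

/-- Strong analytic controllability on `M`: from every state in `M ∩ D`, the states reachable at
any prescribed time `t > t₀` are exactly those of `M ∩ D`. -/
def IsStronglyAnalyticallyControllable (H₀ : Module.End ℂ D) (Hc : Fin r → Module.End ℂ D)
    (M : Set 𝓗) : Prop :=
  ∀ t₀ t : ℝ, t₀ < t → ∀ ψ ∈ M ∩ D, reachableSet H₀ Hc M t₀ t ψ = M ∩ D

end QuantumControl

end

/-! The obstacle is the drift, which only runs forward and cannot be switched off. Large controls
acting for a short time imitate every flow of `𝓑` at no cost of time, up to closure
(`preserves_control_limitReach`). An impulse given a time `σ` before the end appears at the end as a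
flow generated by an element of `Ad (U_σ) 𝓑`, where `U` is the flow of the drift. The condition `[𝓑,
𝓒] ⊂ 𝓑` ensures that the other impulses do not spoil this (`IsImpulsive.insert`). Differentiation in
`σ` then yields all `ad_{H₀}ⁿ 𝓑`, hence `𝓒`: the closure of the impulsively reached states at time
`T` is invariant under the group generated by `𝓒` (`lieC_le_stabilizer_impulsive`).

This group consists of isometries, and `𝓒 ψ` is the whole tangent space by a dimension count. So its
orbits contain relative balls of a fixed radius, and by connectedness `closure M` is one orbit
(`exists_groupC_apply_eq`). Two things follow: forward motions reach every neighbourhood at every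
exact positive time (`exists_isForward_norm_lt`), and, since motions normalize the group, backward
motions also stay in `closure M` (`IsForward.inv_mem_closure`).

To pass from approximate to exact steering, one trades time between successive controls near the
target `χ`. Differences of generators contain no drift, the total duration `τ < T` is unchanged, and
the resulting variations cover `𝓒 χ` (`exists_hasExactFamily`). Thus for some motion `w`, the images
`w z` of the states `z` that can be steered to `χ` in time exactly `τ` fill a neighbourhood of `χ`
in `M`. The time `T - τ` suffices to come close enough to `w⁻¹ χ`, and the two motions are
concatenated.

The operators are unbounded. Analytic vectors make them differentiable along flows, and the flows
act on the finite-dimensional `L` by matrix exponentials, so the Lie algebra can be done there. -/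

noncomputable section

namespace QuantumControl

open Filter Topology

section

/-! ### Power series along the real line -/

theorem hasDerivAt_of_hasSum_pow {E : Type*} [NormedAddCommGroup E] [NormedSpace ℝ E]
    {a : ℕ → E} {f : ℝ → E} {s : ℝ} (hs : 0 < s)
    (h : ∀ t : ℝ, |t| < s → HasSum (fun n => (t ^ n / (n.factorial : ℝ)) • a n) (f t)) :
    HasDerivAt f (a 1) 0 := by
  let p : FormalMultilinearSeries ℝ ℝ E :=
    fun n => ContinuousMultilinearMap.mkPiRing ℝ (Fin n) (((n.factorial : ℝ)⁻¹) • a n)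
  have hp : HasFPowerSeriesAt f p 0 := by
    rw [hasFPowerSeriesAt_iff]
    have : ∀ᶠ z : ℝ in 𝓝 0, |z| < s := by
      filter_upwards [Metric.ball_mem_nhds (0 : ℝ) hs] with z hz
      simpa [Real.norm_eq_abs] using hz
    filter_upwards [this] with z hz
    have hc : ∀ n, p.coeff n = ((n.factorial : ℝ)⁻¹) • a n := by
      intro n
      simp [p, FormalMultilinearSeries.coeff]
    simp only [zero_add, hc, smul_smul]
    simpa [div_eq_mul_inv] using h z hz
  simpa [p] using hp.hasDerivAt

/-! ### Unitary operators preserving the domain -/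

variable {𝓗 : Type*} [NormedAddCommGroup 𝓗] [InnerProductSpace ℂ 𝓗]
variable {D : Submodule ℂ 𝓗}

variable (D) in
/-- The unitary operators that map the domain `D` onto itself. -/
def domainGroup : Subgroup (𝓗 ≃ₗᵢ[ℂ] 𝓗) where
  carrier := {g | ∀ x, g x ∈ D ↔ x ∈ D}
  mul_mem' := by
    intro a b ha hb x
    simp only [Set.mem_ofPred_eq, LinearIsometryEquiv.coe_mul, Function.comp_apply] at *
    rw [ha, hb]
  one_mem' := by intro x; simp
  inv_mem' := by
    intro a ha x
    have h1 : a (a⁻¹ x) = x := a.apply_symm_apply x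
    rw [← ha (a⁻¹ x), h1]

/-- The action of the domain group on the domain. -/
def dom : domainGroup D →* Module.End ℂ D where
  toFun g :=
    { toFun := fun x => ⟨(g : 𝓗 ≃ₗᵢ[ℂ] 𝓗) x, (g.2 x).2 x.2⟩
      map_add' := by intro x y; ext; simp
      map_smul' := by intro c x; ext; simp }
  map_one' := by ext; simp
  map_mul' := by intro g h; ext; simp

@[simp] theorem coe_dom (g : domainGroup D) (x : D) :
    ((dom g x : D) : 𝓗) = (g : 𝓗 ≃ₗᵢ[ℂ] 𝓗) x := rfl

theorem dom_mul_apply (g h : domainGroup D) (x : D) : dom (g * h) x = dom g (dom h x) := by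
  rw [map_mul]; rfl

@[simp] theorem dom_inv_dom (g : domainGroup D) (x : D) : dom g⁻¹ (dom g x) = x := by
  rw [← dom_mul_apply]; simp

@[simp] theorem dom_dom_inv (g : domainGroup D) (x : D) : dom g (dom g⁻¹ x) = x := by
  rw [← dom_mul_apply]; simp

/-- The adjoint action of the domain group on operators. -/
def Ad (g : domainGroup D) : Module.End ℂ D →ₗ[ℝ] Module.End ℂ D :=
  (LinearMap.mulLeft ℝ (dom g)).comp (LinearMap.mulRight ℝ (dom g⁻¹))

theorem Ad_def (g : domainGroup D) (Y : Module.End ℂ D) : Ad g Y = dom g * (Y * dom g⁻¹) := rfl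

theorem Ad_apply (g : domainGroup D) (Y : Module.End ℂ D) (x : D) :
    Ad g Y x = dom g (Y (dom g⁻¹ x)) := rfl

@[simp] theorem Ad_one (Y : Module.End ℂ D) : Ad (1 : domainGroup D) Y = Y := by
  simp [Ad_def]

theorem Ad_mul (g h : domainGroup D) (Y : Module.End ℂ D) : Ad (g * h) Y = Ad g (Ad h Y) := by
  simp [Ad_def, mul_assoc]

@[simp] theorem Ad_inv_Ad (g : domainGroup D) (Y : Module.End ℂ D) : Ad g⁻¹ (Ad g Y) = Y := by
  rw [← Ad_mul]; simp

@[simp] theorem Ad_Ad_inv (g : domainGroup D) (Y : Module.End ℂ D) : Ad g (Ad g⁻¹ Y) = Y := by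
  rw [← Ad_mul]; simp

/-- Moving an operator past a unitary. -/
theorem apply_dom (g : domainGroup D) (Y : Module.End ℂ D) (x : D) :
    Y (dom g x) = dom g (Ad g⁻¹ Y x) := by
  simp [Ad_apply]

/-! ### Lie algebras of operators with analytic flows -/

/-- A Lie algebra of skew-Hermitian operators on a dense domain of analytic vectors, together with
the one-parameter unitary groups that its elements generate. -/
structure AnalyticFlow (L : LieSubalgebra ℝ (Module.End ℂ D)) where
  dense : Dense (D : Set 𝓗)
  skew : ∀ X ∈ L, IsSkewHermitian X
  analytic : ∀ w : D, IsAnalyticVector L w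
  unitary : L → ℝ → (𝓗 ≃ₗᵢ[ℂ] 𝓗)
  isExp : ∀ X : L, IsExponentialGroup (X : Module.End ℂ D) (unitary X)

namespace AnalyticFlow

variable {L : LieSubalgebra ℝ (Module.End ℂ D)} (F : AnalyticFlow L)

include F in
theorem finiteDimensional : FiniteDimensional ℝ L := by
  obtain ⟨d, b, -⟩ := F.analytic 0
  exact Module.Finite.of_basis b

theorem unitary_zero (X : L) (x : 𝓗) : F.unitary X 0 x = x := by
  have h := (F.isExp X).map_add 0 0 x
  rw [add_zero] at h
  exact ((F.unitary X 0).injective h).symm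

/-- The one-parameter group of `X`, as a subgroup of the domain group. -/
def U (X : L) (t : ℝ) : domainGroup D :=
  ⟨F.unitary X t, fun x => ⟨fun h => by
    have h1 := (F.isExp X).invariant (-t) _ h
    rwa [← (F.isExp X).map_add, neg_add_cancel, F.unitary_zero] at h1,
    (F.isExp X).invariant t x⟩⟩

@[simp] theorem U_zero (X : L) : F.U X 0 = 1 := by
  ext x; exact F.unitary_zero X x

theorem U_add (X : L) (s t : ℝ) : F.U X (s + t) = F.U X s * F.U X t := by
  ext x; exact (F.isExp X).map_add s t x

theorem U_neg (X : L) (t : ℝ) : F.U X (-t) = (F.U X t)⁻¹ := by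
  rw [eq_inv_iff_mul_eq_one, ← U_add]; simp

theorem continuous_U (X : L) (x : 𝓗) :
    Continuous fun t => (F.U X t : 𝓗 ≃ₗᵢ[ℂ] 𝓗) x := (F.isExp X).continuous x

theorem hasDerivAt_U_zero (X : L) (x : D) :
    HasDerivAt (fun t => (F.U X t : 𝓗 ≃ₗᵢ[ℂ] 𝓗) (x : 𝓗))
      (((X : Module.End ℂ D) x : D) : 𝓗) 0 := by
  obtain ⟨s, hs, h⟩ := (F.isExp X).local_exp x
  have := hasDerivAt_of_hasSum_pow (a := fun n => ((((X : Module.End ℂ D) ^ n) x : D) : 𝓗)) hs h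
  rwa [pow_one] at this

theorem hasDerivAt_U (X : L) (x : D) (t : ℝ) :
    HasDerivAt (fun t => (F.U X t : 𝓗 ≃ₗᵢ[ℂ] 𝓗) (x : 𝓗))
      (((X : Module.End ℂ D) (dom (F.U X t) x) : D) : 𝓗) t := by
  have h := F.hasDerivAt_U_zero X (dom (F.U X t) x)
  have h2 : HasDerivAt (fun s => s - t) (1 : ℝ) t := (hasDerivAt_id t).sub_const t
  have h3 := HasDerivAt.scomp t (by simpa using h) h2
  rw [one_smul] at h3
  refine h3.congr_of_eventuallyEq (Eventually.of_forall fun s => ?_)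
  have : F.U X s = F.U X (s - t) * F.U X t := by rw [← U_add]; simp
  simp [this]

include F in
theorem inner_left_skew {X : Module.End ℂ D} (hX : X ∈ L) (x y : D) :
    inner ℂ ((X x : D) : 𝓗) (y : 𝓗) = - inner ℂ (x : 𝓗) ((X y : D) : 𝓗) := F.skew X hX x y

include F in
theorem eq_of_inner_right {x y : 𝓗} (h : ∀ d : D, inner ℂ (d : 𝓗) x = inner ℂ (d : 𝓗) y) :
    x = y :=
  F.dense.eq_of_inner_right ℂ fun d hd => h ⟨d, hd⟩

/-- Curves in the domain that solve `y' = X y` are orbits of the group of `X`. -/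
theorem eq_U_of_hasDerivAt (X : L) (y : ℝ → D)
    (hy : ∀ t, HasDerivAt (fun t => (y t : 𝓗)) (((X : Module.End ℂ D) (y t) : D) : 𝓗) t) (t : ℝ) :
    y t = dom (F.U X t) (y 0) := by
  -- Skewness of `X` makes the pairing of two solutions constant, which gives uniqueness without any
  -- bound on `X`.
  have key : ∀ d : D, inner ℂ ((F.U X t : 𝓗 ≃ₗᵢ[ℂ] 𝓗) (d : 𝓗)) (y t : 𝓗)
      = inner ℂ (d : 𝓗) (y 0 : 𝓗) := by
    intro d
    have hd : ∀ s, HasDerivAt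
        (fun s => inner ℂ ((F.U X s : 𝓗 ≃ₗᵢ[ℂ] 𝓗) (d : 𝓗)) (y s : 𝓗)) 0 s := by
      intro s
      have := (F.hasDerivAt_U X d s).inner ℂ (hy s)
      rw [F.inner_left_skew X.2] at this
      simpa using this
    have := is_const_of_deriv_eq_zero (fun s => (hd s).differentiableAt)
      (fun s => (hd s).deriv) t 0
    simpa using this
  have : (F.U X t : 𝓗 ≃ₗᵢ[ℂ] 𝓗).symm (y t : 𝓗) = (y 0 : 𝓗) := by
    apply F.eq_of_inner_right
    intro d
    rw [← key d, ← (F.U X t : 𝓗 ≃ₗᵢ[ℂ] 𝓗).inner_map_map]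
    simp
  ext
  rw [coe_dom, ← this]
  simp

include F in
theorem ext_dom {g h : domainGroup D} (hgh : ∀ x : D, dom g x = dom h x) : g = h := by
  ext x
  have : (fun x => (g : 𝓗 ≃ₗᵢ[ℂ] 𝓗) x) = fun x => (h : 𝓗 ≃ₗᵢ[ℂ] 𝓗) x := by
    refine Continuous.ext_on F.dense (by fun_prop) (by fun_prop) ?_
    intro x hx
    exact congrArg Subtype.val (hgh ⟨x, hx⟩)
  exact congrFun this x

theorem U_eq_of_hasDerivAt (X : L) (V : ℝ → domainGroup D) (h0 : V 0 = 1)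
    (hV : ∀ (x : D) t, HasDerivAt (fun t => (V t : 𝓗 ≃ₗᵢ[ℂ] 𝓗) (x : 𝓗))
      (((X : Module.End ℂ D) (dom (V t) x) : D) : 𝓗) t) (t : ℝ) : V t = F.U X t := by
  apply F.ext_dom
  intro x
  have := F.eq_U_of_hasDerivAt X (fun t => dom (V t) x) (hV x) t
  simpa [h0] using this

theorem U_smul (X : L) (c t : ℝ) : F.U (c • X) t = F.U X (c * t) := by
  symm
  apply F.U_eq_of_hasDerivAt (c • X) (fun t => F.U X (c * t)) (by simp)
  intro x t
  have h := HasDerivAt.scomp t (F.hasDerivAt_U X x (c * t)) ((hasDerivAt_id t).const_mul c)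
  rw [mul_one] at h
  exact h

theorem U_conj (g : domainGroup D) (Y Z : L) (h : (Z : Module.End ℂ D) = Ad g Y) (t : ℝ) :
    F.U Z t = g * F.U Y t * g⁻¹ := by
  symm
  apply F.U_eq_of_hasDerivAt Z (fun t => g * F.U Y t * g⁻¹) (by simp)
  intro x t
  have h1 := F.hasDerivAt_U Y (dom g⁻¹ x) t
  have h2 := ((g : 𝓗 ≃ₗᵢ[ℂ] 𝓗).toContinuousLinearEquiv.toContinuousLinearMap.restrictScalars
    ℝ).hasFDerivAt.comp_hasDerivAt t h1
  rw [h, Ad_apply]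
  simp only [dom_mul_apply, dom_inv_dom]
  exact h2

end AnalyticFlow

end

section

variable {𝓗 : Type*} [NormedAddCommGroup 𝓗] [InnerProductSpace ℂ 𝓗]
variable {D : Submodule ℂ 𝓗}

/-! ### Operators along the flow -/

/-- Expansion of the power into words in the `b i`. The operator `T` in front is arbitrary so that
the induction can move one factor at a time into it. -/
theorem norm_apply_pow_le {d : ℕ} (b : Fin d → Module.End ℂ D) (x : Fin d → ℝ) {K : ℝ}
    (hK : 0 ≤ K) (hx : ∀ i, |x i| ≤ K) (w : D) (n : ℕ) (T : Module.End ℂ D) :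
    ‖T (((∑ i, x i • b i) ^ n) w)‖ ≤
      K ^ n * ∑ i : Fin n → Fin d, ‖T ((List.ofFn fun k => b (i k)).prod w)‖ := by
  induction n generalizing T with
  | zero => simp
  | succ n ih =>
    have h1 := ih (T * ∑ i, x i • b i)
    rw [pow_succ']
    refine le_trans h1 ?_
    have h2 : ∑ i : Fin (n + 1) → Fin d, ‖T ((List.ofFn fun k => b (i k)).prod w)‖
        = ∑ i : Fin n → Fin d, ∑ j : Fin d,
          ‖T (b j ((List.ofFn fun k => b (i k)).prod w))‖ := by
      rw [Finset.sum_comm, ← Fintype.sum_prod_type']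
      symm
      refine Fintype.sum_equiv (Fin.consEquiv (fun _ => Fin d)) _ _ ?_
      rintro ⟨j, i⟩
      simp [Fin.consEquiv]
    rw [h2, pow_succ, mul_assoc]
    refine mul_le_mul_of_nonneg_left ?_ (pow_nonneg hK n)
    rw [Finset.mul_sum _ _ K]
    refine Finset.sum_le_sum fun i _ => ?_
    rw [Finset.mul_sum _ _ K]
    have h3 : (T * ∑ i, x i • b i) ((List.ofFn fun k => b (i k)).prod w)
        = ∑ j, x j • T (b j ((List.ofFn fun k => b (i k)).prod w)) := by
      rw [Module.End.mul_apply, LinearMap.sum_apply, map_sum]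
      refine Finset.sum_congr rfl fun j _ => ?_
      rw [LinearMap.smul_apply]
      exact LinearMap.map_smul_of_tower T (x j) _
    rw [h3]
    refine (norm_sum_le _ _).trans (Finset.sum_le_sum fun j _ => ?_)
    rw [norm_smul]
    exact mul_le_mul_of_nonneg_right (hx j) (norm_nonneg _)

/-- The additional operator `Z` lengthens every word by one letter, so the `n`-th term is compared
with the term of index `n + 1` of the analytic vector series. The lost factor `n + 1` is absorbed by
halving the radius. -/
theorem IsAnalyticVector.exists_summable {L : LieSubalgebra ℝ (Module.End ℂ D)} {w : D}
    (hw : IsAnalyticVector L w) {X Z : Module.End ℂ D} (hX : X ∈ L) (hZ : Z ∈ L) :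
    ∃ δ > 0, ∀ t : ℝ, |t| < δ →
      Summable fun n : ℕ => ‖(t ^ n / (n.factorial : ℝ)) • ((Z ((X ^ n) w) : D) : 𝓗)‖ := by
  obtain ⟨d, b, s, hs, hsum⟩ := hw
  set B : Fin d → Module.End ℂ D := fun i => (b i : Module.End ℂ D) with hB
  have hrep : ∀ Y : L, (Y : Module.End ℂ D) = ∑ i, b.repr Y i • B i := by
    intro Y
    have := congrArg L.toSubmodule.subtype (b.sum_repr Y)
    rw [map_sum] at this
    exact this.symm
  set x : Fin d → ℝ := fun i => b.repr ⟨X, hX⟩ i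
  set z : Fin d → ℝ := fun i => b.repr ⟨Z, hZ⟩ i
  have hXr : X = ∑ i, x i • B i := hrep ⟨X, hX⟩
  have hZr : Z = ∑ i, z i • B i := hrep ⟨Z, hZ⟩
  obtain ⟨K, hK0, hKx, hKz⟩ : ∃ K : ℝ, 0 < K ∧ (∀ i, |x i| ≤ K) ∧ ∀ i, |z i| ≤ K := by
    refine ⟨1 + ∑ i, |x i| + ∑ i, |z i|, ?_, fun i => ?_, fun i => ?_⟩
    · have h1 : 0 ≤ ∑ i, |x i| := Finset.sum_nonneg fun _ _ => abs_nonneg _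
      have h2 : 0 ≤ ∑ i, |z i| := Finset.sum_nonneg fun _ _ => abs_nonneg _
      linarith
    · have h1 := Finset.single_le_sum (f := fun i => |x i|) (fun _ _ => abs_nonneg _)
        (Finset.mem_univ i)
      have h2 : 0 ≤ ∑ i, |z i| := Finset.sum_nonneg fun _ _ => abs_nonneg _
      linarith
    · have h1 := Finset.single_le_sum (f := fun i => |z i|) (fun _ _ => abs_nonneg _)
        (Finset.mem_univ i)
      have h2 : 0 ≤ ∑ i, |x i| := Finset.sum_nonneg fun _ _ => abs_nonneg _
      linarith
  set N : ℕ → ℝ := fun n => ∑ i : Fin n → Fin d, ‖(List.ofFn fun k => B (i k)).prod w‖ with hN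
  have hNnn : ∀ n, 0 ≤ N n := fun n => Finset.sum_nonneg fun _ _ => norm_nonneg _
  have hbound : ∀ n, ‖Z ((X ^ n) w)‖ ≤ K ^ (n + 1) * N (n + 1) := by
    intro n
    rw [hXr]
    refine (norm_apply_pow_le B x hK0.le hKx w n Z).trans ?_
    have hZi : ∀ i : Fin n → Fin d, ‖Z ((List.ofFn fun k => B (i k)).prod w)‖
        ≤ K * ∑ j, ‖(B j) ((List.ofFn fun k => B (i k)).prod w)‖ := by
      intro i
      have := norm_apply_pow_le B z hK0.le hKz ((List.ofFn fun k => B (i k)).prod w) 1 1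
      rw [pow_one, pow_one, ← hZr] at this
      refine this.trans (le_of_eq ?_)
      congr 1
      refine Fintype.sum_equiv (Equiv.funUnique (Fin 1) (Fin d)) _ _ fun j => ?_
      simp
    have h2 : N (n + 1) = ∑ i : Fin n → Fin d, ∑ j : Fin d,
        ‖B j ((List.ofFn fun k => B (i k)).prod w)‖ := by
      rw [hN, Finset.sum_comm, ← Fintype.sum_prod_type']
      symm
      refine Fintype.sum_equiv (Fin.consEquiv (fun _ => Fin d)) _ _ ?_
      rintro ⟨j, i⟩
      simp [Fin.consEquiv]
    rw [pow_succ, mul_assoc, h2]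
    refine mul_le_mul_of_nonneg_left ?_ (by positivity)
    rw [Finset.mul_sum _ _ K]
    exact (Finset.sum_le_sum fun i _ => hZi i)
  have hsum' : Summable fun n : ℕ => (1 / ((n + 1).factorial : ℝ)) * N (n + 1) * s ^ (n + 1) :=
    (summable_nat_add_iff 1).2 hsum
  -- `K` bounds the coordinates of `X` and `Z`; the 2 leaves a factor `2⁻ⁿ` against `(n + 1)! / n! =
  -- n + 1`.
  refine ⟨s / (2 * K), by positivity, fun t ht => ?_⟩
  refine Summable.of_nonneg_of_le (fun _ => norm_nonneg _) (fun n => ?_) (hsum'.mul_left (2 * K / s))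
  rw [norm_smul, Real.norm_eq_abs, abs_div, abs_pow, Nat.abs_cast]
  have h1 : (|t| * K) ^ n ≤ (s / 2) ^ n := by
    refine pow_le_pow_left₀ (by positivity) ?_ n
    rw [lt_div_iff₀ (by positivity)] at ht
    linarith
  have h2 : ((n : ℝ) + 1) ≤ 2 * 2 ^ n := by
    have : n + 1 ≤ 2 ^ (n + 1) := (Nat.lt_two_pow_self).le
    have h : ((n + 1 : ℕ) : ℝ) ≤ ((2 ^ (n + 1) : ℕ) : ℝ) := by exact_mod_cast this
    push_cast at h
    rw [pow_succ] at h
    linarith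
  have hf : ((n + 1).factorial : ℝ) = (n + 1) * n.factorial := by
    rw [Nat.factorial_succ]; push_cast; ring
  have hfp : (0 : ℝ) < n.factorial := by positivity
  calc |t| ^ n / (n.factorial : ℝ) * ‖((Z ((X ^ n) w) : D) : 𝓗)‖
      ≤ |t| ^ n / (n.factorial : ℝ) * (K ^ (n + 1) * N (n + 1)) :=
        mul_le_mul_of_nonneg_left (hbound n) (by positivity)
    _ = (|t| * K) ^ n * (K * N (n + 1) / n.factorial) := by rw [mul_pow, pow_succ]; ring
    _ ≤ (s / 2) ^ n * (K * N (n + 1) / n.factorial) :=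
        mul_le_mul_of_nonneg_right h1 (by have := hNnn (n + 1); positivity)
    _ = ((n : ℝ) + 1) * (s ^ n * (K * N (n + 1) / ((n + 1) * n.factorial)) / 2 ^ n) := by
        rw [div_pow]; field_simp
    _ ≤ (2 * 2 ^ n) * (s ^ n * (K * N (n + 1) / ((n + 1) * n.factorial)) / 2 ^ n) :=
        mul_le_mul_of_nonneg_right h2 (by have := hNnn (n + 1); positivity)
    _ = 2 * K / s * (1 / ((n + 1).factorial : ℝ) * N (n + 1) * s ^ (n + 1)) := by
        rw [hf, pow_succ]; field_simp

namespace AnalyticFlow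

variable {L : LieSubalgebra ℝ (Module.End ℂ D)} (F : AnalyticFlow L)

/-- `Z` is not continuous, but being skew on a dense domain it is closable: tested against `d`, it
moves to the other side of the inner product. Hence it may be applied term by term to the
exponential series, whose image series converges by analyticity. -/
theorem hasDerivAt_apply_U_zero [CompleteSpace 𝓗] (X : L) {Z : Module.End ℂ D} (hZ : Z ∈ L)
    (x : D) :
    HasDerivAt (fun t => ((Z (dom (F.U X t) x) : D) : 𝓗))
      ((Z ((X : Module.End ℂ D) x) : D) : 𝓗) 0 := by
  obtain ⟨s, hs, h⟩ := (F.isExp X).local_exp x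
  obtain ⟨δ, hδ, hsum⟩ := (F.analytic x).exists_summable X.2 hZ
  have := hasDerivAt_of_hasSum_pow
    (a := fun n => ((Z (((X : Module.End ℂ D) ^ n) x) : D) : 𝓗))
    (f := fun t => ((Z (dom (F.U X t) x) : D) : 𝓗)) (lt_min hs hδ) ?_
  · rwa [pow_one] at this
  intro t ht
  have h1 := h t (ht.trans_le (min_le_left _ _))
  have h2 := (hsum t (ht.trans_le (min_le_right _ _))).of_norm
  convert h2.hasSum using 1
  apply F.eq_of_inner_right
  intro d
  have e1 : HasSum (fun n : ℕ => inner ℂ ((Z d : D) : 𝓗)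
      ((t ^ n / (n.factorial : ℝ)) • ((((X : Module.End ℂ D) ^ n) x : D) : 𝓗)))
      (inner ℂ ((Z d : D) : 𝓗) ((dom (F.U X t) x : D) : 𝓗)) :=
    h1.mapL (innerSL ℂ ((Z d : D) : 𝓗))
  have e2 : HasSum (fun n : ℕ => inner ℂ (d : 𝓗)
      ((t ^ n / (n.factorial : ℝ)) • ((Z (((X : Module.End ℂ D) ^ n) x) : D) : 𝓗)))
      (inner ℂ (d : 𝓗)
        (∑' n : ℕ, (t ^ n / (n.factorial : ℝ)) • ((Z (((X : Module.End ℂ D) ^ n) x) : D) : 𝓗))) :=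
    h2.hasSum.mapL (innerSL ℂ (d : 𝓗))
  have e3 := e1.neg
  rw [F.inner_left_skew hZ, neg_neg] at e3
  have hfun : ∀ n : ℕ, inner ℂ (d : 𝓗)
      ((t ^ n / (n.factorial : ℝ)) • ((Z (((X : Module.End ℂ D) ^ n) x) : D) : 𝓗)) =
      - inner ℂ ((Z d : D) : 𝓗)
        ((t ^ n / (n.factorial : ℝ)) • ((((X : Module.End ℂ D) ^ n) x : D) : 𝓗)) := by
    intro n
    have h4 := F.inner_left_skew hZ d ((t ^ n / (n.factorial : ℝ)) • ((X : Module.End ℂ D) ^ n) x)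
    rw [LinearMap.map_smul_of_tower] at h4
    exact (neg_eq_iff_eq_neg.2 h4).symm
  simp only [hfun] at e2
  exact e3.unique e2

theorem hasDerivAt_apply_U [CompleteSpace 𝓗] (X : L) {Z : Module.End ℂ D} (hZ : Z ∈ L)
    (x : D) (t : ℝ) :
    HasDerivAt (fun t => ((Z (dom (F.U X t) x) : D) : 𝓗))
      ((Z ((X : Module.End ℂ D) (dom (F.U X t) x)) : D) : 𝓗) t := by
  have h := F.hasDerivAt_apply_U_zero X hZ (dom (F.U X t) x)
  have h2 : HasDerivAt (fun s => s - t) (1 : ℝ) t := (hasDerivAt_id t).sub_const t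
  have h3 := HasDerivAt.scomp t (by simpa using h) h2
  rw [one_smul] at h3
  refine h3.congr_of_eventuallyEq (Eventually.of_forall fun s => ?_)
  have : F.U X s = F.U X (s - t) * F.U X t := by rw [← U_add]; simp
  simp [this]

end AnalyticFlow

end

section

/-! ### The adjoint action of the flows -/

section MatrixExp

open scoped Matrix.Norms.Operator

theorem hasDerivAt_matrix_exp_apply {k : ℕ} (A : Matrix (Fin k) (Fin k) ℝ) (i j : Fin k) (t : ℝ) :
    HasDerivAt (fun t : ℝ => NormedSpace.exp (t • A) i j) ((NormedSpace.exp (t • A) * A) i j) t := by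
  have h := hasDerivAt_exp_smul_const (𝕂 := ℝ) A t
  exact ((Matrix.entryLinearMap ℝ ℝ i j).toContinuousLinearMap.hasFDerivAt).comp_hasDerivAt t h

end MatrixExp

variable {𝓗 : Type*} [NormedAddCommGroup 𝓗] [InnerProductSpace ℂ 𝓗] [CompleteSpace 𝓗]
variable {D : Submodule ℂ 𝓗}

omit [CompleteSpace 𝓗] in
theorem lie_real_smul (X Y : Module.End ℂ D) (c : ℝ) : ⁅X, c • Y⁆ = c • ⁅X, Y⁆ := by
  simp [LieRing.of_associative_ring_bracket, smul_sub]

namespace AnalyticFlow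

variable {L : LieSubalgebra ℝ (Module.End ℂ D)} (F : AnalyticFlow L)

/-- The functions `⟨d, Ad (U_t) (b i) x⟩` solve the linear system with matrix `A`. Working with
these scalar functions avoids any topology on the unbounded operators. -/
theorem Ad_U_eq_matrix_exp (X : L) {k : ℕ} (b : Fin k → Module.End ℂ D) (hb : ∀ i, b i ∈ L)
    (A : Matrix (Fin k) (Fin k) ℝ) (hA : ∀ i, ⁅(X : Module.End ℂ D), b i⁆ = ∑ j, A i j • b j)
    (t : ℝ) (i : Fin k) :
    Ad (F.U X t) (b i) = ∑ j, NormedSpace.exp (t • A) i j • b j := by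
  ext x
  apply F.eq_of_inner_right
  intro d
  set g : Fin k → ℝ → ℂ := fun i t =>
    inner ℂ ((dom (F.U X (-t)) d : D) : 𝓗) ((b i (dom (F.U X (-t)) x) : D) : 𝓗) with hg
  have hneg : ∀ t : ℝ, HasDerivAt (fun s : ℝ => -s) (-1) t := fun t => (hasDerivAt_id t).neg
  have hgd : ∀ i t, HasDerivAt (g i) (∑ j, A i j • g j t) t := by
    intro i t
    have h1 := HasDerivAt.scomp t (F.hasDerivAt_U X d (-t)) (hneg t)
    have h2 := HasDerivAt.scomp t (F.hasDerivAt_apply_U X (hb i) x (-t)) (hneg t)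
    have h3 := h1.inner ℂ h2
    refine h3.congr_deriv ?_
    have e := congrArg (fun T : Module.End ℂ D => inner ℂ ((dom (F.U X (-t)) d : D) : 𝓗)
      ((T (dom (F.U X (-t)) x) : D) : 𝓗)) (hA i)
    simp only [LieRing.of_associative_ring_bracket, LinearMap.sub_apply, Module.End.mul_apply,
      Submodule.coe_sub, inner_sub_right, LinearMap.sum_apply, Submodule.coe_sum, inner_sum,
      LinearMap.smul_apply] at e
    have e2 : ∀ j, inner ℂ ((dom (F.U X (-t)) d : D) : 𝓗)
        ((A i j • (b j (dom (F.U X (-t)) x)) : D) : 𝓗) = A i j • g j t := by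
      intro j
      exact (innerSL ℂ ((dom (F.U X (-t)) d : D) : 𝓗)).map_smul_of_tower (A i j) _
    simp only [e2] at e
    rw [← e]
    simp only [Function.comp_apply, neg_smul, one_smul, inner_neg_right, inner_neg_left]
    have e3 := F.inner_left_skew X.2 (dom (F.U X (-t)) d) (b i (dom (F.U X (-t)) x))
    rw [e3]
    simp only [coe_dom]
    ring
  -- Multiplying the solution by `exp (-t A)` turns it into a constant.
  set h : Fin k → ℝ → ℂ := fun i t => ∑ j, NormedSpace.exp ((-t) • A) i j • g j t with hh
  have hhd : ∀ i t, HasDerivAt (h i) 0 t := by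
    intro i t
    have h1 : ∀ j, HasDerivAt (fun t : ℝ => NormedSpace.exp ((-t) • A) i j • g j t)
        (NormedSpace.exp ((-t) • A) i j • (∑ l, A j l • g l t)
          + (-(NormedSpace.exp ((-t) • A) * A) i j) • g j t) t := by
      intro j
      have h2 := HasDerivAt.scomp t (hasDerivAt_matrix_exp_apply A i j (-t)) (hneg t)
      refine (HasDerivAt.smul h2 (hgd j t)).congr_deriv ?_
      simp
    refine (HasDerivAt.fun_sum fun j _ => h1 j).congr_deriv ?_
    rw [Finset.sum_add_distrib]
    simp only [Matrix.mul_apply, neg_smul, Finset.sum_neg_distrib, Finset.smul_sum, Finset.sum_smul,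
      smul_smul]
    rw [Finset.sum_comm, add_neg_cancel]
  have hconst : ∀ i t, h i t = g i 0 := by
    intro i t
    have h1 := is_const_of_deriv_eq_zero (fun s => (hhd i s).differentiableAt)
      (fun s => (hhd i s).deriv) t 0
    rw [h1]
    simp only [hh, neg_zero, zero_smul, NormedSpace.exp_zero, Matrix.one_apply, ite_smul, one_smul,
      Finset.sum_ite_eq, Finset.mem_univ, if_true]
  have hinv : NormedSpace.exp (t • A) * NormedSpace.exp ((-t) • A) = 1 := by
    rw [← Matrix.exp_add_of_commute]
    · simp
    · exact ((Commute.refl A).smul_left t).smul_right (-t)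
  have hfin : g i t = ∑ j, NormedSpace.exp (t • A) i j • g j 0 := by
    have : ∀ j, g j 0 = h j t := fun j => (hconst j t).symm
    simp only [this, hh, Finset.smul_sum, smul_smul]
    rw [Finset.sum_comm]
    simp only [← Finset.sum_smul, ← Matrix.mul_apply, hinv, Matrix.one_apply]
    simp
  have hl : inner ℂ (d : 𝓗) ((Ad (F.U X t) (b i) x : D) : 𝓗) = g i t := by
    rw [Ad_apply, hg]
    simp only [F.U_neg]
    rw [← (F.U X t : 𝓗 ≃ₗᵢ[ℂ] 𝓗).inner_map_map ((dom (F.U X t)⁻¹ d : D) : 𝓗), ← coe_dom,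
      ← coe_dom, dom_dom_inv]
  rw [hl, hfin]
  simp only [LinearMap.sum_apply, Submodule.coe_sum, inner_sum, LinearMap.smul_apply]
  refine Finset.sum_congr rfl fun j _ => ?_
  rw [hg]
  simp only [neg_zero, U_zero, map_one, Module.End.one_apply]
  exact ((innerSL ℂ (d : 𝓗)).map_smul_of_tower (NormedSpace.exp (t • A) i j) _).symm

/-- A subspace of `L` that is stable under `ad X` is stable under the flow of `X`. -/
theorem Ad_U_mem (X : L) {S : Submodule ℝ (Module.End ℂ D)} (hS : S ≤ L.toSubmodule)
    (hX : ∀ Y ∈ S, ⁅(X : Module.End ℂ D), Y⁆ ∈ S) (t : ℝ) {Y : Module.End ℂ D} (hY : Y ∈ S) :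
    Ad (F.U X t) Y ∈ S := by
  have := F.finiteDimensional
  have : FiniteDimensional ℝ L.toSubmodule := F.finiteDimensional
  have : FiniteDimensional ℝ S := Submodule.finiteDimensional_of_le hS
  have : Module.Free ℝ S := Module.Free.of_divisionRing ℝ S
  let b := Module.finBasis ℝ S
  have hrep : ∀ Z (hZ : Z ∈ S), Z = ∑ j, b.repr ⟨Z, hZ⟩ j • (b j : Module.End ℂ D) := by
    intro Z hZ
    have := congrArg S.subtype (b.sum_repr ⟨Z, hZ⟩)
    rw [map_sum] at this
    exact this.symm
  have key := F.Ad_U_eq_matrix_exp X (fun j => (b j : Module.End ℂ D)) (fun j => hS (b j).2)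
    (fun i j => b.repr ⟨_, hX _ (b i).2⟩ j) (fun i => hrep _ _) t
  rw [hrep Y hY, map_sum]
  refine S.sum_mem fun j _ => ?_
  rw [map_smul, key]
  exact S.smul_mem _ (S.sum_mem fun l _ => S.smul_mem _ (b l).2)

theorem Ad_U_mem_L (X : L) (t : ℝ) {Y : Module.End ℂ D} (hY : Y ∈ L) : Ad (F.U X t) Y ∈ L :=
  F.Ad_U_mem X (S := L.toSubmodule) le_rfl (fun _ h => L.lie_mem X.2 h) t hY

/-- Linear functionals replace a topology on the space of operators: on the finite-dimensional `L`
all of them are differentiable along the flow. -/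
theorem hasDerivAt_functional_Ad (X : L) {Y : Module.End ℂ D} (hY : Y ∈ L)
    (f : Module.End ℂ D →ₗ[ℝ] ℝ) :
    HasDerivAt (fun t => f (Ad (F.U X t) Y)) (f ⁅(X : Module.End ℂ D), Y⁆) 0 := by
  have := F.finiteDimensional
  let b := Module.finBasis ℝ L
  have hrep : ∀ Z (hZ : Z ∈ L), Z = ∑ j, b.repr ⟨Z, hZ⟩ j • (b j : Module.End ℂ D) := by
    intro Z hZ
    have := congrArg L.toSubmodule.subtype (b.sum_repr ⟨Z, hZ⟩)
    rw [map_sum] at this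
    exact this.symm
  obtain ⟨A, hA⟩ : ∃ A : Matrix (Fin (Module.finrank ℝ L)) (Fin (Module.finrank ℝ L)) ℝ,
      ∀ i, ⁅(X : Module.End ℂ D), (b i : Module.End ℂ D)⁆
        = ∑ j, A i j • (b j : Module.End ℂ D) :=
    ⟨fun i j => b.repr ⟨_, L.lie_mem X.2 (b i).2⟩ j, fun i => hrep _ _⟩
  have key := F.Ad_U_eq_matrix_exp X (fun j => (b j : Module.End ℂ D)) (fun j => (b j).2) A hA
  have e1 : ∀ t, f (Ad (F.U X t) Y)
      = ∑ i, b.repr ⟨Y, hY⟩ i * ∑ j, NormedSpace.exp (t • A) i j * f (b j) := by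
    intro t
    conv_lhs => rw [hrep Y hY]
    simp [map_sum, key]
  simp only [e1]
  have e2 : HasDerivAt (fun t : ℝ => ∑ i, b.repr ⟨Y, hY⟩ i *
      ∑ j, NormedSpace.exp (t • A) i j * f (b j))
      (∑ i, b.repr ⟨Y, hY⟩ i * ∑ j, (NormedSpace.exp ((0 : ℝ) • A) * A) i j * f (b j)) 0 :=
    HasDerivAt.fun_sum fun i _ => (HasDerivAt.fun_sum fun j _ =>
      (hasDerivAt_matrix_exp_apply A i j 0).mul_const _).const_mul _
  refine e2.congr_deriv ?_
  conv_rhs => rw [hrep Y hY]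
  simp only [lie_sum, lie_real_smul, map_sum, map_smul, hA, smul_eq_mul, zero_smul,
    NormedSpace.exp_zero, one_mul]

/-- If the flow of `X` moves `Y` inside a subspace `S` for small positive times, then `S` contains
`Y` and `[X, Y]`. -/
theorem mem_and_lie_mem_of_Ad_mem (X : L) {S : Submodule ℝ (Module.End ℂ D)}
    {Y : Module.End ℂ D} (hY : Y ∈ L) (h : ∀ᶠ t in 𝓝[>] (0 : ℝ), Ad (F.U X t) Y ∈ S) :
    Y ∈ S ∧ ⁅(X : Module.End ℂ D), Y⁆ ∈ S := by
  -- It suffices to test with functionals vanishing on `S`. The value at 0 and the right derivative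
  -- at 0 are determined by small positive times, the only ones available for forward motions.
  have main : ∀ f : Module.End ℂ D →ₗ[ℝ] ℝ, S ≤ LinearMap.ker f →
      f Y = 0 ∧ f ⁅(X : Module.End ℂ D), Y⁆ = 0 := by
    intro f hf
    have hd := F.hasDerivAt_functional_Ad X hY f
    have hev : ∀ᶠ t in 𝓝[>] (0 : ℝ), f (Ad (F.U X t) Y) = 0 := h.mono fun t ht => hf ht
    have h0 : f Y = 0 := by
      have hc : Tendsto (fun t => f (Ad (F.U X t) Y)) (𝓝[>] (0 : ℝ)) (𝓝 (f Y)) := by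
        have := hd.continuousAt.tendsto
        simp only [U_zero, Ad_one] at this
        exact this.mono_left nhdsWithin_le_nhds
      exact tendsto_nhds_unique (hc.congr' hev) tendsto_const_nhds |>.symm ▸ rfl
    refine ⟨h0, ?_⟩
    have hw : HasDerivWithinAt (fun t => f (Ad (F.U X t) Y)) (f ⁅(X : Module.End ℂ D), Y⁆)
        (Set.Ioi 0) 0 := hd.hasDerivWithinAt
    have hz : HasDerivWithinAt (fun t => f (Ad (F.U X t) Y)) 0 (Set.Ioi 0) 0 :=
      (hasDerivWithinAt_const (0 : ℝ) (Set.Ioi (0 : ℝ)) (0 : ℝ)).congr_of_eventuallyEq hev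
        (by simpa using h0)
    exact (uniqueDiffWithinAt_Ioi (0 : ℝ)).eq_deriv _ hw hz
  constructor
  · by_contra hcon
    obtain ⟨f, hf1, hf2⟩ := Submodule.exists_le_ker_of_notMem hcon
    exact hf1 (main f hf2).1
  · by_contra hcon
    obtain ⟨f, hf1, hf2⟩ := Submodule.exists_le_ker_of_notMem hcon
    exact hf1 (main f hf2).2

end AnalyticFlow

end

section

variable {𝓗 : Type*} [NormedAddCommGroup 𝓗] [InnerProductSpace ℂ 𝓗] [CompleteSpace 𝓗]
variable {D : Submodule ℂ 𝓗}

/-! ### Regular families of states -/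

namespace AnalyticFlow

variable {L : LieSubalgebra ℝ (Module.End ℂ D)} (F : AnalyticFlow L)

/-- Moving `Z` past a flow produces finitely many fixed operators with continuous coefficients; this
is what keeps the continuity clause of `IsRegularAt` stable under flows. -/
theorem exists_Ad_expansion (X : L) {Z : Module.End ℂ D} (hZ : Z ∈ L) :
    ∃ (k : ℕ) (b : Fin k → Module.End ℂ D) (c : Fin k → ℝ → ℝ), (∀ j, b j ∈ L) ∧
      (∀ j, Continuous (c j)) ∧ ∀ t, Ad (F.U X t) Z = ∑ j, c j t • b j := by
  have := F.finiteDimensional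
  let b := Module.finBasis ℝ L
  have hrep : ∀ Z (hZ : Z ∈ L), Z = ∑ j, b.repr ⟨Z, hZ⟩ j • (b j : Module.End ℂ D) := by
    intro Z hZ
    have := congrArg L.toSubmodule.subtype (b.sum_repr ⟨Z, hZ⟩)
    rw [map_sum] at this
    exact this.symm
  obtain ⟨A, hA⟩ : ∃ A : Matrix (Fin (Module.finrank ℝ L)) (Fin (Module.finrank ℝ L)) ℝ,
      ∀ i, ⁅(X : Module.End ℂ D), (b i : Module.End ℂ D)⁆
        = ∑ j, A i j • (b j : Module.End ℂ D) :=
    ⟨fun i j => b.repr ⟨_, L.lie_mem X.2 (b i).2⟩ j, fun i => hrep _ _⟩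
  have key := F.Ad_U_eq_matrix_exp X (fun j => (b j : Module.End ℂ D)) (fun j => (b j).2) A hA
  refine ⟨_, fun j => (b j : Module.End ℂ D),
    fun j t => ∑ i, b.repr ⟨Z, hZ⟩ i * NormedSpace.exp (t • A) i j, fun j => (b j).2,
    fun j => ?_, fun t => ?_⟩
  · refine continuous_finsetSum _ fun i _ => continuous_const.mul ?_
    exact continuous_iff_continuousAt.2 fun t =>
      (hasDerivAt_matrix_exp_apply A i j t).continuousAt
  · conv_lhs => rw [hrep Z hZ]
    simp only [map_sum, map_smul, key, Finset.smul_sum, smul_smul, Finset.sum_smul]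
    rw [Finset.sum_comm]

-- Both sides are the derivative at `s = 0` of `U_{t+s} x`, once as `U_s U_t x` and once as `U_t U_s
-- x`.
omit [CompleteSpace 𝓗] in
theorem apply_U_comm (X : L) (t : ℝ) (x : D) :
    (X : Module.End ℂ D) (dom (F.U X t) x) = dom (F.U X t) ((X : Module.End ℂ D) x) := by
  have h1 : HasDerivAt (fun s => (F.U X (t + s) : 𝓗 ≃ₗᵢ[ℂ] 𝓗) (x : 𝓗))
      (((X : Module.End ℂ D) (dom (F.U X t) x) : D) : 𝓗) 0 := by
    have h := F.hasDerivAt_U_zero X (dom (F.U X t) x)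
    refine h.congr_of_eventuallyEq (Eventually.of_forall fun s => ?_)
    simp [add_comm t s, U_add]
  have h2 := ((F.U X t : 𝓗 ≃ₗᵢ[ℂ] 𝓗).toContinuousLinearEquiv.toContinuousLinearMap.restrictScalars
    ℝ).hasFDerivAt.comp_hasDerivAt 0 (F.hasDerivAt_U_zero X x)
  have h3 : HasDerivAt (fun s => (F.U X (t + s) : 𝓗 ≃ₗᵢ[ℂ] 𝓗) (x : 𝓗))
      ((dom (F.U X t) ((X : Module.End ℂ D) x) : D) : 𝓗) 0 := by
    refine h2.congr_of_eventuallyEq (Eventually.of_forall fun s => ?_)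
    simp [U_add]
  exact Subtype.ext (h1.unique h3)

omit [CompleteSpace 𝓗] in
theorem continuousAt_U_apply {V : Type*} [TopologicalSpace V] (X : L) {a : V → ℝ} {h : V → 𝓗}
    {v : V} (ha : ContinuousAt a v) (hh : ContinuousAt h v) :
    ContinuousAt (fun w => (F.U X (a w) : 𝓗 ≃ₗᵢ[ℂ] 𝓗) (h w)) v := by
  have h1 : Tendsto (fun w => (F.U X (a w) : 𝓗 ≃ₗᵢ[ℂ] 𝓗) (h w - h v)) (𝓝 v) (𝓝 0) := by
    rw [tendsto_zero_iff_norm_tendsto_zero]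
    simp only [LinearIsometryEquiv.norm_map]
    rw [← tendsto_zero_iff_norm_tendsto_zero]
    simpa using hh.tendsto.sub_const (h v)
  have h2 : Tendsto (fun w => (F.U X (a w) : 𝓗 ≃ₗᵢ[ℂ] 𝓗) (h v)) (𝓝 v)
      (𝓝 ((F.U X (a v) : 𝓗 ≃ₗᵢ[ℂ] 𝓗) (h v))) :=
    ((F.continuous_U X (h v)).tendsto _).comp ha
  have h3 := h1.add h2
  simpa [ContinuousAt] using h3

/-- A family of states in the domain is regular if it is strictly differentiable and remains
continuous after application of the operators in `L`. -/
structure IsRegularAt {V : Type*} [NormedAddCommGroup V] [NormedSpace ℝ V]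
    (_F : AnalyticFlow L) (f : V → D) (f' : V →L[ℝ] 𝓗) (v : V) : Prop where
  strict : HasStrictFDerivAt (fun w => (f w : 𝓗)) f' v
  cont : ∀ Z ∈ L, ContinuousAt (fun w => ((Z (f w) : D) : 𝓗)) v

/-- A unitary operator, as a real continuous linear map. -/
def realCLM (g : 𝓗 ≃ₗᵢ[ℂ] 𝓗) : 𝓗 →L[ℝ] 𝓗 :=
  g.toContinuousLinearEquiv.toContinuousLinearMap.restrictScalars ℝ

omit [CompleteSpace 𝓗] in
@[simp] theorem realCLM_apply (g : 𝓗 ≃ₗᵢ[ℂ] 𝓗) (x : 𝓗) : realCLM g x = g x := rfl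

variable {V : Type*} [NormedAddCommGroup V] [NormedSpace ℝ V]

omit [CompleteSpace 𝓗] in
theorem isRegularAt_const (x : D) (v : V) : F.IsRegularAt (fun _ => x) 0 v :=
  ⟨hasStrictFDerivAt_const _ _, fun _ _ => continuousAt_const⟩

omit [CompleteSpace 𝓗] in
theorem IsRegularAt.comp_clm {F : AnalyticFlow L} {V' : Type*} [NormedAddCommGroup V']
    [NormedSpace ℝ V'] {f : V → D} {f' : V →L[ℝ] 𝓗} (A : V' →L[ℝ] V) {v : V'}
    (h : F.IsRegularAt f f' (A v)) : F.IsRegularAt (fun w => f (A w)) (f'.comp A) v :=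
  ⟨h.strict.comp v A.hasStrictFDerivAt, fun Z hZ =>
    ContinuousAt.comp (f := A) (h.cont Z hZ) A.continuous.continuousAt⟩

/-- The time derivative of the flow is `Y` applied to the state, so strict differentiability needs
`Y (f v)` to be continuous in `v`, not only `f`. Strictness is what the open mapping argument on `M`
later uses. -/
theorem IsRegularAt.flow {F : AnalyticFlow L} [FiniteDimensional ℝ V] {f : V → D}
    {f' : V →L[ℝ] 𝓗} {v₀ : V} (h : F.IsRegularAt f f' v₀) (Y : L) {a : V → ℝ} {a' : V →L[ℝ] ℝ}
    (ha : HasStrictFDerivAt a a' v₀) :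
    F.IsRegularAt (fun v => dom (F.U Y (a v)) (f v))
      ((realCLM (F.U Y (a v₀) : 𝓗 ≃ₗᵢ[ℂ] 𝓗)).comp f' +
        a'.smulRight (((Y : Module.End ℂ D) (dom (F.U Y (a v₀)) (f v₀)) : D) : 𝓗)) v₀ := by
  have hac : ContinuousAt a v₀ := ha.continuousAt
  have hfst : Tendsto Prod.fst (𝓝 (v₀, v₀)) (𝓝 v₀) := continuous_fst.tendsto (v₀, v₀)
  have hsnd : Tendsto Prod.snd (𝓝 (v₀, v₀)) (𝓝 v₀) := continuous_snd.tendsto (v₀, v₀)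
  constructor
  · rw [hasStrictFDerivAt_iff_isLittleO]
    set y : 𝓗 := (((Y : Module.End ℂ D) (dom (F.U Y (a v₀)) (f v₀)) : D) : 𝓗) with hy
    have hy' : y = (F.U Y (a v₀) : 𝓗 ≃ₗᵢ[ℂ] 𝓗) (((Y : Module.End ℂ D) (f v₀) : D) : 𝓗) := by
      rw [hy, F.apply_U_comm]; rfl
    -- The error splits into four parts: the remainder of `f`, the change of the unitary in front of
    -- `f'`, the motion in time at a fixed state, and the remainder of `a`.
    have h1 : (fun p : V × V => (F.U Y (a p.1) : 𝓗 ≃ₗᵢ[ℂ] 𝓗)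
        ((f p.1 : 𝓗) - f p.2 - f' (p.1 - p.2))) =o[𝓝 (v₀, v₀)] fun p => p.1 - p.2 := by
      have := hasStrictFDerivAt_iff_isLittleO.1 h.strict
      refine Asymptotics.IsLittleO.of_norm_left (this.norm_left.congr_left fun p => ?_)
      rw [LinearIsometryEquiv.norm_map]
    have h2 : (fun p : V × V => (F.U Y (a p.1) : 𝓗 ≃ₗᵢ[ℂ] 𝓗) (f' (p.1 - p.2)) -
        (F.U Y (a v₀) : 𝓗 ≃ₗᵢ[ℂ] 𝓗) (f' (p.1 - p.2))) =o[𝓝 (v₀, v₀)] fun p => p.1 - p.2 := by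
      -- Strong continuity becomes norm continuity because `V` is finite-dimensional.
      have hc : Continuous fun t : ℝ => (realCLM (F.U Y t : 𝓗 ≃ₗᵢ[ℂ] 𝓗)).comp f' := by
        rw [continuous_clm_apply]
        intro v
        exact F.continuous_U Y (f' v)
      have ht : Tendsto (fun p : V × V => (realCLM (F.U Y (a p.1) : 𝓗 ≃ₗᵢ[ℂ] 𝓗)).comp f' -
          (realCLM (F.U Y (a v₀) : 𝓗 ≃ₗᵢ[ℂ] 𝓗)).comp f') (𝓝 (v₀, v₀)) (𝓝 0) := by
        have := ((hc.tendsto (a v₀)).comp (hac.tendsto.comp hfst)).sub_const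
          ((realCLM (F.U Y (a v₀) : 𝓗 ≃ₗᵢ[ℂ] 𝓗)).comp f')
        simpa using this
      rw [Asymptotics.isLittleO_iff]
      intro c hc0
      filter_upwards [ht.norm.eventually (gt_mem_nhds (by simpa using hc0))] with p hp
      have := ((realCLM (F.U Y (a p.1) : 𝓗 ≃ₗᵢ[ℂ] 𝓗)).comp f' -
          (realCLM (F.U Y (a v₀) : 𝓗 ≃ₗᵢ[ℂ] 𝓗)).comp f').le_opNorm (p.1 - p.2)
      exact this.trans (mul_le_mul_of_nonneg_right hp.le (norm_nonneg _))
    have h3 : (fun p : V × V => (F.U Y (a p.1) : 𝓗 ≃ₗᵢ[ℂ] 𝓗) (f p.2 : 𝓗) -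
        (F.U Y (a p.2) : 𝓗 ≃ₗᵢ[ℂ] 𝓗) (f p.2 : 𝓗) - (a p.1 - a p.2) • y) =o[𝓝 (v₀, v₀)]
        fun p => p.1 - p.2 := by
      have hO : (fun p : V × V => a p.1 - a p.2) =O[𝓝 (v₀, v₀)] fun p => p.1 - p.2 := ha.isBigO_sub
      refine Asymptotics.IsLittleO.trans_isBigO ?_ hO
      rw [Asymptotics.isLittleO_iff]
      intro c hc0
      have hU : ∀ᶠ s in 𝓝 (a v₀),
          ‖(F.U Y s : 𝓗 ≃ₗᵢ[ℂ] 𝓗) (((Y : Module.End ℂ D) (f v₀) : D) : 𝓗) - y‖ < c / 2 := by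
        have := ((F.continuous_U Y (((Y : Module.End ℂ D) (f v₀) : D) : 𝓗)).tendsto
          (a v₀)).sub_const y
        rw [← hy', sub_self] at this
        exact this.norm.eventually (gt_mem_nhds (by simpa using half_pos hc0))
      -- Mean value inequality for `s ↦ U_s (f p.2) - s • y`, whose derivative stays below `c` on
      -- this ball of times.
      obtain ⟨δ, hδ, hball⟩ := Metric.eventually_nhds_iff_ball.1 hU
      have hf : ∀ᶠ w in 𝓝 v₀, ‖(((Y : Module.End ℂ D) (f w) : D) : 𝓗) -
          (((Y : Module.End ℂ D) (f v₀) : D) : 𝓗)‖ < c / 2 := by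
        have := (h.cont Y Y.2).tendsto.sub_const (((Y : Module.End ℂ D) (f v₀) : D) : 𝓗)
        rw [sub_self] at this
        exact this.norm.eventually (gt_mem_nhds (by simpa using half_pos hc0))
      have hb : ∀ᶠ w in 𝓝 v₀, a w ∈ Metric.ball (a v₀) δ := hac (Metric.ball_mem_nhds _ hδ)
      filter_upwards [hfst.eventually hb, hsnd.eventually hb, hsnd.eventually hf] with p p1 p2 p3
      have hd : ∀ s ∈ Metric.ball (a v₀) δ, HasDerivWithinAt
          (fun s => (F.U Y s : 𝓗 ≃ₗᵢ[ℂ] 𝓗) (f p.2 : 𝓗) - s • y)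
          ((F.U Y s : 𝓗 ≃ₗᵢ[ℂ] 𝓗) (((Y : Module.End ℂ D) (f p.2) : D) : 𝓗) - y)
          (Metric.ball (a v₀) δ) s := by
        intro s _
        have e1 := F.hasDerivAt_U Y (f p.2) s
        rw [F.apply_U_comm] at e1
        have e2 := (hasDerivAt_id s).smul_const y
        rw [one_smul] at e2
        exact (e1.sub e2).hasDerivWithinAt
      have := (convex_ball (a v₀) δ).norm_image_sub_le_of_norm_hasDerivWithin_le (C := c) hd
        (fun s hs => ?_) p2 p1
      · convert this using 2
        rw [sub_smul]; abel
      · have e : (F.U Y s : 𝓗 ≃ₗᵢ[ℂ] 𝓗) (((Y : Module.End ℂ D) (f p.2) : D) : 𝓗) - y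
            = (F.U Y s : 𝓗 ≃ₗᵢ[ℂ] 𝓗) ((((Y : Module.End ℂ D) (f p.2) : D) : 𝓗) -
              (((Y : Module.End ℂ D) (f v₀) : D) : 𝓗)) +
              ((F.U Y s : 𝓗 ≃ₗᵢ[ℂ] 𝓗) (((Y : Module.End ℂ D) (f v₀) : D) : 𝓗) - y) := by
          rw [map_sub]; abel
        rw [e]
        refine (norm_add_le _ _).trans ?_
        rw [LinearIsometryEquiv.norm_map]
        have := hball s hs
        linarith
    have h4 : (fun p : V × V => (a p.1 - a p.2 - a' (p.1 - p.2)) • y) =o[𝓝 (v₀, v₀)]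
        fun p => p.1 - p.2 := by
      have e1 := hasStrictFDerivAt_iff_isLittleO.1 ha
      refine Asymptotics.IsLittleO.of_norm_left
        ((e1.norm_left.const_mul_left ‖y‖).congr_left fun p => ?_)
      rw [norm_smul, mul_comm]
    refine (((h1.add h2).add h3).add h4).congr_left fun p => ?_
    simp only [coe_dom, map_sub, _root_.add_apply, ContinuousLinearMap.comp_apply,
      realCLM_apply, ContinuousLinearMap.smulRight_apply, sub_smul]
    abel
  · intro Z hZ
    obtain ⟨k, b, c, hb, hc, hZc⟩ := F.exists_Ad_expansion Y hZ
    have e : ∀ v, ((Z (dom (F.U Y (a v)) (f v)) : D) : 𝓗) =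
        ∑ j, c j (-a v) • (F.U Y (a v) : 𝓗 ≃ₗᵢ[ℂ] 𝓗) ((b j (f v) : D) : 𝓗) := by
      intro v
      rw [apply_dom, ← F.U_neg, hZc]
      simp only [LinearMap.sum_apply, LinearMap.smul_apply, map_sum, Submodule.coe_sum]
      refine Finset.sum_congr rfl fun j _ => ?_
      rw [LinearMap.map_smul_of_tower]
      rfl
    simp only [e]
    refine tendsto_finsetSum _ fun j _ => Tendsto.smul ?_ ?_
    · exact ((hc j).tendsto _).comp hac.neg
    · exact F.continuousAt_U_apply Y hac (h.cont _ (hb j))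

/-! ### Dependence of the flow on the generator -/

/-- In the derivative of the squared norm of the difference `v` the generator drops out by skewness.
Only the pairing of `v` with `ε Z U_t x` remains, and it is bounded on the compact time interval.
The resulting rate `√ε` is enough. -/
theorem norm_U_add_smul_sub_le (X Z : L) (x : D) :
    ∃ C : ℝ, 0 ≤ C ∧ ∀ ε : ℝ, 0 ≤ ε →
      ‖(F.U (X + ε • Z) 1 : 𝓗 ≃ₗᵢ[ℂ] 𝓗) (x : 𝓗) - (F.U X 1 : 𝓗 ≃ₗᵢ[ℂ] 𝓗) (x : 𝓗)‖ ^ 2 ≤ ε * C := by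
  have hcont : ContinuousOn (fun t => (((Z : Module.End ℂ D) (dom (F.U X t) x) : D) : 𝓗))
      (Set.Icc 0 1) := fun t _ => (F.hasDerivAt_apply_U X Z.2 x t).continuousAt.continuousWithinAt
  obtain ⟨C, hC⟩ := isCompact_Icc.exists_bound_of_continuousOn hcont
  have hC0 : 0 ≤ C := (norm_nonneg _).trans (hC 0 (by simp))
  refine ⟨2 * ((2 * ‖(x : 𝓗)‖) * C), by positivity, fun ε hε => ?_⟩
  set W : L := X + ε • Z with hW
  have hWc : ∀ z : D, (W : Module.End ℂ D) z =
      (X : Module.End ℂ D) z + ε • (Z : Module.End ℂ D) z := fun z => rfl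
  set v : ℝ → D := fun t => dom (F.U W t) x - dom (F.U X t) x with hv
  have hvd : ∀ t, HasDerivAt (fun t => (v t : 𝓗)) (((W : Module.End ℂ D) (v t) : D) +
      ε • (((Z : Module.End ℂ D) (dom (F.U X t) x) : D) : 𝓗)) t := by
    intro t
    refine ((F.hasDerivAt_U W x t).sub (F.hasDerivAt_U X x t)).congr_deriv ?_
    have e : (((W : Module.End ℂ D) (dom (F.U X t) x) : D) : 𝓗) =
        (((X : Module.End ℂ D) (dom (F.U X t) x) : D) : 𝓗) +
          ε • (((Z : Module.End ℂ D) (dom (F.U X t) x) : D) : 𝓗) := by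
      rw [hWc]; rfl
    simp only [hv, map_sub, Submodule.coe_sub]
    rw [e]
    abel
  have hnd : ∀ t, HasDerivAt (fun t => inner ℂ (v t : 𝓗) (v t : 𝓗))
      (ε • (inner ℂ (v t : 𝓗) (((Z : Module.End ℂ D) (dom (F.U X t) x) : D) : 𝓗) +
        inner ℂ (((Z : Module.End ℂ D) (dom (F.U X t) x) : D) : 𝓗) (v t : 𝓗))) t := by
    intro t
    refine ((hvd t).inner ℂ (hvd t)).congr_deriv ?_
    rw [inner_add_left, inner_add_right, F.inner_left_skew W.2, ← Complex.coe_smul,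
      inner_smul_left, inner_smul_right, Complex.conj_ofReal, Complex.real_smul]
    ring
  have hvn : ∀ t, ‖(v t : 𝓗)‖ ≤ 2 * ‖(x : 𝓗)‖ := by
    intro t
    refine (norm_sub_le _ _).trans ?_
    simp [two_mul]
  have := norm_image_sub_le_of_norm_deriv_le_segment_01' (f := fun t => inner ℂ (v t : 𝓗) (v t : 𝓗))
    (C := ε * (2 * ((2 * ‖(x : 𝓗)‖) * C))) (fun t _ => (hnd t).hasDerivWithinAt) (fun t ht => ?_)
  · have h0 : v 0 = 0 := by simp [hv]
    rw [h0] at this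
    simp only [Submodule.coe_zero, inner_zero_left, sub_zero] at this
    rw [inner_self_eq_norm_sq_to_K] at this
    simpa [hv] using this
  · have h1 := hC t ⟨ht.1, ht.2.le⟩
    have h2 := hvn t
    rw [norm_smul, Real.norm_of_nonneg hε]
    refine mul_le_mul_of_nonneg_left ?_ hε
    refine (norm_add_le _ _).trans ?_
    have h3 := norm_inner_le_norm (𝕜 := ℂ) (v t : 𝓗)
      (((Z : Module.End ℂ D) (dom (F.U X t) x) : D) : 𝓗)
    have h4 := norm_inner_le_norm (𝕜 := ℂ)
      (((Z : Module.End ℂ D) (dom (F.U X t) x) : D) : 𝓗) (v t : 𝓗)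
    have h5 : ‖(v t : 𝓗)‖ * ‖(((Z : Module.End ℂ D) (dom (F.U X t) x) : D) : 𝓗)‖
        ≤ (2 * ‖(x : 𝓗)‖) * C := mul_le_mul h2 h1 (norm_nonneg _) (by positivity)
    rw [mul_comm] at h4
    linarith

theorem tendsto_U_add_smul (X Z : L) (x : D) :
    Tendsto (fun ε : ℝ => (F.U (X + ε • Z) 1 : 𝓗 ≃ₗᵢ[ℂ] 𝓗) (x : 𝓗)) (𝓝[>] 0)
      (𝓝 ((F.U X 1 : 𝓗 ≃ₗᵢ[ℂ] 𝓗) (x : 𝓗))) := by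
  obtain ⟨C, hC0, hC⟩ := F.norm_U_add_smul_sub_le X Z x
  rw [tendsto_iff_norm_sub_tendsto_zero]
  have h1 : Tendsto (fun ε : ℝ => √(ε * C)) (𝓝[>] 0) (𝓝 0) := by
    have : Continuous fun ε : ℝ => √(ε * C) := by fun_prop
    have h := this.tendsto 0
    simp only [zero_mul, Real.sqrt_zero] at h
    exact h.mono_left nhdsWithin_le_nhds
  refine squeeze_zero' (Eventually.of_forall fun _ => norm_nonneg _) ?_ h1
  filter_upwards [self_mem_nhdsWithin] with ε hε
  exact Real.le_sqrt_of_sq_le (hC ε (le_of_lt hε))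

end AnalyticFlow

end

section

variable {𝓗 : Type*} [NormedAddCommGroup 𝓗] [InnerProductSpace ℂ 𝓗] [CompleteSpace 𝓗]
variable {D : Submodule ℂ 𝓗}

/-! ### Invariance of closed sets -/

namespace AnalyticFlow

variable {L : LieSubalgebra ℝ (Module.End ℂ D)} (F : AnalyticFlow L)

theorem hasDerivAt_U_U (X Y : L) (x : D) :
    HasDerivAt (fun t => (F.U X t : 𝓗 ≃ₗᵢ[ℂ] 𝓗) ((F.U Y t : 𝓗 ≃ₗᵢ[ℂ] 𝓗) (x : 𝓗)))
      ((((X + Y : L) : Module.End ℂ D) x : D) : 𝓗) 0 := by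
  have h0 := F.isRegularAt_const x (0 : ℝ)
  have h1 := h0.flow Y (hasStrictFDerivAt_id (𝕜 := ℝ) (0 : ℝ))
  have h2 := h1.flow X (hasStrictFDerivAt_id (𝕜 := ℝ) (0 : ℝ))
  refine h2.strict.hasFDerivAt.hasDerivAt.congr_deriv ?_
  simp [add_comm]

/-- The generators whose flow preserves the set `A`. -/
def Preserves (X : L) (A : Set 𝓗) : Prop := ∀ t, ∀ a ∈ A, (F.U X t : 𝓗 ≃ₗᵢ[ℂ] 𝓗) a ∈ A

variable {F}

omit [CompleteSpace 𝓗] in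
theorem Preserves.smul {X : L} {A : Set 𝓗} (h : F.Preserves X A) (c : ℝ) :
    F.Preserves (c • X) A := by
  intro t a ha
  rw [F.U_smul]
  exact h _ a ha

omit [CompleteSpace 𝓗] in
theorem infDist_le_of_mapsTo {A : Set 𝓗} (hA : A.Nonempty) (g : 𝓗 ≃ₗᵢ[ℂ] 𝓗)
    (h : ∀ a ∈ A, g a ∈ A) (x : 𝓗) : Metric.infDist (g x) A ≤ Metric.infDist x A := by
  refine (Metric.le_infDist hA).2 fun {a} ha => ?_
  rw [← g.dist_map x a]
  exact Metric.infDist_le_dist_of_mem (h a ha)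

/-- To first order the flow of `X + Y` is the product of the two flows, which are isometries
preserving `A` and so do not increase the distance to `A`. The distance along the flow of `X + Y`
therefore has nonpositive upper right derivative. -/
theorem Preserves.add_of_nonneg {X Y : L} {A : Set 𝓗} (hA : IsClosed A) (hX : F.Preserves X A)
    (hY : F.Preserves Y A) {T : ℝ} (hT : 0 ≤ T) {a : 𝓗} (ha : a ∈ A) :
    (F.U (X + Y) T : 𝓗 ≃ₗᵢ[ℂ] 𝓗) a ∈ A := by
  have hne : A.Nonempty := ⟨a, ha⟩
  have hD : ∀ x : D, Metric.infDist ((F.U (X + Y) T : 𝓗 ≃ₗᵢ[ℂ] 𝓗) (x : 𝓗)) A ≤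
      Metric.infDist (x : 𝓗) A := by
    intro x
    have hcont : Continuous fun t =>
        Metric.infDist ((F.U (X + Y) t : 𝓗 ≃ₗᵢ[ℂ] 𝓗) (x : 𝓗)) A :=
      (Metric.continuous_infDist_pt A).comp (F.continuous_U (X + Y) x)
    refine image_le_of_liminf_slope_right_le_deriv_boundary (a := 0) (b := T)
      (f := fun t => Metric.infDist ((F.U (X + Y) t : 𝓗 ≃ₗᵢ[ℂ] 𝓗) (x : 𝓗)) A)
      (B := fun _ => Metric.infDist (x : 𝓗) A) (B' := fun _ => 0)
      hcont.continuousOn (by simp) continuousOn_const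
      (fun _ _ => hasDerivWithinAt_const _ _ _) ?_ ⟨hT, le_rfl⟩
    intro s _ r hr
    set q : D := dom (F.U (X + Y) s) x with hq
    have hd := (F.hasDerivAt_U_zero (X + Y) q).sub (F.hasDerivAt_U_U X Y q)
    rw [sub_self] at hd
    have ho := (hasDerivAt_iff_isLittleO.1 hd).def (half_pos hr)
    have htend : Tendsto (fun z => z - s) (𝓝[>] s) (𝓝 0) := by
      have : Tendsto (fun z => z - s) (𝓝 s) (𝓝 (s - s)) := tendsto_id.sub_const s
      rw [sub_self] at this
      exact this.mono_left nhdsWithin_le_nhds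
    refine Eventually.frequently ?_
    filter_upwards [htend.eventually ho, self_mem_nhdsWithin] with z hz hzs
    have hzs' : 0 < z - s := sub_pos.2 hzs
    simp only [Pi.sub_apply, U_zero, OneMemClass.coe_one, LinearIsometryEquiv.coe_one, id_eq,
      sub_self, smul_zero, sub_zero, Real.norm_of_nonneg hzs'.le] at hz
    rw [slope_def_field, div_lt_iff₀ hzs']
    have e1 : (F.U (X + Y) z : 𝓗 ≃ₗᵢ[ℂ] 𝓗) (x : 𝓗) =
        (F.U (X + Y) (z - s) : 𝓗 ≃ₗᵢ[ℂ] 𝓗) (q : 𝓗) := by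
      have : F.U (X + Y) z = F.U (X + Y) (z - s) * F.U (X + Y) s := by rw [← U_add]; simp
      rw [this]; simp [hq]
    have e2 : (F.U (X + Y) s : 𝓗 ≃ₗᵢ[ℂ] 𝓗) (x : 𝓗) = (q : 𝓗) := rfl
    rw [e1, e2]
    have h1 := Metric.infDist_le_infDist_add_dist (s := A)
      (x := (F.U (X + Y) (z - s) : 𝓗 ≃ₗᵢ[ℂ] 𝓗) (q : 𝓗))
      (y := (F.U X (z - s) : 𝓗 ≃ₗᵢ[ℂ] 𝓗) ((F.U Y (z - s) : 𝓗 ≃ₗᵢ[ℂ] 𝓗) (q : 𝓗)))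
    have h2 := infDist_le_of_mapsTo hne _ (hX (z - s)) ((F.U Y (z - s) : 𝓗 ≃ₗᵢ[ℂ] 𝓗) (q : 𝓗))
    have h3 := infDist_le_of_mapsTo hne _ (hY (z - s)) (q : 𝓗)
    rw [dist_eq_norm] at h1
    have h4 : r / 2 * (z - s) < r * (z - s) := by nlinarith
    linarith
  -- The state `a` need not lie in `D`, where the derivatives make sense, so the inequality is
  -- carried over by density.
  have hall : ∀ x : 𝓗, Metric.infDist ((F.U (X + Y) T : 𝓗 ≃ₗᵢ[ℂ] 𝓗) x) A ≤
      Metric.infDist x A := by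
    have hcl : IsClosed {x : 𝓗 | Metric.infDist ((F.U (X + Y) T : 𝓗 ≃ₗᵢ[ℂ] 𝓗) x) A ≤
        Metric.infDist x A} :=
      isClosed_le ((Metric.continuous_infDist_pt A).comp
        (F.U (X + Y) T : 𝓗 ≃ₗᵢ[ℂ] 𝓗).continuous) (Metric.continuous_infDist_pt A)
    intro x
    have : closure (D : Set 𝓗) ⊆ {x : 𝓗 | Metric.infDist ((F.U (X + Y) T : 𝓗 ≃ₗᵢ[ℂ] 𝓗) x) A ≤
        Metric.infDist x A} := closure_minimal (fun x hx => hD ⟨x, hx⟩) hcl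
    exact this (F.dense x)
  have := hall a
  rw [Metric.infDist_zero_of_mem ha] at this
  exact (hA.mem_iff_infDist_zero hne).2 (le_antisymm this Metric.infDist_nonneg)

theorem Preserves.add {X Y : L} {A : Set 𝓗} (hA : IsClosed A) (hX : F.Preserves X A)
    (hY : F.Preserves Y A) : F.Preserves (X + Y) A := by
  intro t a ha
  rcases le_total 0 t with ht | ht
  · exact hX.add_of_nonneg hA hY ht ha
  · have h := (hX.smul (-1)).add_of_nonneg hA (hY.smul (-1)) (neg_nonneg.2 ht) ha
    rw [← smul_add, F.U_smul] at h
    simpa using h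

variable (F) in
/-- The space of the generators whose flow preserves a given closed set. -/
def stabilizerSubmodule (A : Set 𝓗) (hA : IsClosed A) : Submodule ℝ (Module.End ℂ D) where
  carrier := {Z | ∃ h : Z ∈ L, F.Preserves ⟨Z, h⟩ A}
  add_mem' := by
    rintro Z W ⟨hZ, hZ'⟩ ⟨hW, hW'⟩
    exact ⟨L.add_mem hZ hW, hZ'.add hA hW'⟩
  zero_mem' := ⟨L.zero_mem, by
    intro t a ha
    have h := F.U_smul 0 0 t
    rw [zero_smul, zero_mul, U_zero] at h
    change (F.U 0 t : 𝓗 ≃ₗᵢ[ℂ] 𝓗) a ∈ A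
    rw [h]
    exact ha⟩
  smul_mem' := by
    rintro c Z ⟨hZ, hZ'⟩
    exact ⟨L.smul_mem c hZ, hZ'.smul c⟩

/-- For a closed set, the generators whose flow preserves it form a Lie algebra. -/
theorem Preserves.lie {X Y : L} {A : Set 𝓗} (hA : IsClosed A) (hX : F.Preserves X A)
    (hY : F.Preserves Y A) :
    F.Preserves ⟨⁅(X : Module.End ℂ D), (Y : Module.End ℂ D)⁆, L.lie_mem X.2 Y.2⟩ A := by
  let S := F.stabilizerSubmodule A hA
  -- The flow of `Ad (U_t) Y` is a conjugate of that of `Y` by a unitary preserving `A`; the bracket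
  -- is its derivative in `t`, and the generators already form a linear space.
  have hev : ∀ t, Ad (F.U X t) (Y : Module.End ℂ D) ∈ S := by
    intro t
    refine ⟨F.Ad_U_mem_L X t Y.2, fun s a ha => ?_⟩
    rw [F.U_conj (F.U X t) Y ⟨_, F.Ad_U_mem_L X t Y.2⟩ rfl, ← F.U_neg]
    simp only [Subgroup.coe_mul, LinearIsometryEquiv.coe_mul, Function.comp_apply]
    exact hX _ _ (hY _ _ (hX _ _ ha))
  obtain ⟨h, h'⟩ := (F.mem_and_lie_mem_of_Ad_mem X (S := S) Y.2 (Eventually.of_forall hev)).2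
  exact h'

variable (F) in
/-- The Lie algebra of the generators whose flow preserves a given closed set. -/
def stabilizer (A : Set 𝓗) (hA : IsClosed A) : LieSubalgebra ℝ (Module.End ℂ D) where
  __ := F.stabilizerSubmodule A hA
  lie_mem' := by
    rintro Z W ⟨hZ, hZ'⟩ ⟨hW, hW'⟩
    exact ⟨L.lie_mem hZ hW, hZ'.lie hA hW'⟩

end AnalyticFlow

end

section

/-! ### Local structure of embedded submanifolds -/

section Manifold

variable {𝓗 : Type*} [NormedAddCommGroup 𝓗] [NormedSpace ℝ 𝓗]

theorem exists_clm_leftInverse {E : Type*} [NormedAddCommGroup E] [NormedSpace ℝ E]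
    [FiniteDimensional ℝ E] (A : E →L[ℝ] 𝓗) (hA : Function.Injective A) :
    ∃ P : 𝓗 →L[ℝ] E, P.comp A = ContinuousLinearMap.id ℝ E := by
  let e := LinearEquiv.ofInjective (A : E →ₗ[ℝ] 𝓗) hA
  have : FiniteDimensional ℝ (LinearMap.range (A : E →ₗ[ℝ] 𝓗)) := inferInstance
  obtain ⟨P, hP⟩ := ContinuousLinearMap.exist_extension_of_finiteDimensional_range
    (LinearMap.toContinuousLinearMap e.symm.toLinearMap)
  refine ⟨P, ?_⟩
  ext x
  have h := congrArg (fun f => f (e x)) hP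
  simp only [LinearMap.coe_toContinuousLinearMap', LinearEquiv.coe_coe,
    LinearEquiv.symm_apply_apply, ContinuousLinearMap.comp_apply] at h
  exact h.symm

/-- Points of `M` near `φ v` are parametrized by points near `v`. -/
theorem IsLocalParam.image_mem_nhdsWithin {m : ℕ} {M : Set 𝓗}
    {V : Set (EuclideanSpace ℝ (Fin m))} {φ : EuclideanSpace ℝ (Fin m) → 𝓗}
    (h : IsLocalParam m M V φ) {v : EuclideanSpace ℝ (Fin m)} (hv : v ∈ V)
    {N : Set (EuclideanSpace ℝ (Fin m))} (hN : N ∈ 𝓝 v) : φ '' (N ∩ V) ∈ 𝓝[M] (φ v) := by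
  obtain ⟨U, hU, hUV⟩ := h.image_eq
  have hN' : Subtype.val ⁻¹' N ∈ 𝓝 (⟨v, hv⟩ : V) := continuous_subtype_val.continuousAt hN
  rw [h.embedding.nhds_eq_comap, mem_comap] at hN'
  obtain ⟨O, hO, hON⟩ := hN'
  have hφU : φ v ∈ U := (hUV.subset ⟨v, hv, rfl⟩).2
  rw [mem_nhdsWithin_iff_exists_mem_nhds_inter]
  refine ⟨O ∩ U, inter_mem hO (hU.mem_nhds hφU), ?_⟩
  rintro y ⟨⟨hyO, hyU⟩, hyM⟩
  obtain ⟨x, hx, rfl⟩ := hUV.superset ⟨hyM, hyU⟩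
  exact ⟨x, ⟨hON (show (⟨x, hx⟩ : V) ∈ V.domRestrict φ ⁻¹' O from hyO), hx⟩, rfl⟩

theorem IsLocalParam.mapsTo {m : ℕ} {M : Set 𝓗}
    {V : Set (EuclideanSpace ℝ (Fin m))} {φ : EuclideanSpace ℝ (Fin m) → 𝓗}
    (h : IsLocalParam m M V φ) {v : EuclideanSpace ℝ (Fin m)} (hv : v ∈ V) : φ v ∈ M := by
  obtain ⟨U, -, hUV⟩ := h.image_eq
  exact (hUV.subset ⟨v, hv, rfl⟩).1

/-- Submanifolds are locally closed: near `p`, `M` lies in the compact image of a compact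
neighbourhood in the chart. This later allows arguments about `closure M` to be brought back to `M`.
-/
theorem HasTangentSpaceAt.exists_ball_inter_closure_subset {m : ℕ} {M : Set 𝓗} {p : 𝓗}
    {T : Submodule ℝ 𝓗} (h : HasTangentSpaceAt m M p T) :
    ∃ r > 0, closure M ∩ Metric.ball p r ⊆ M := by
  obtain ⟨V, φ, hφ, v, hv, rfl, -⟩ := h
  obtain ⟨K, hKv, hKV, hK⟩ := local_compact_nhds (hφ.isOpen.mem_nhds hv)
  have hKim : IsCompact (φ '' K) := hK.image_of_continuousOn (hφ.smooth.continuousOn.mono hKV)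
  have h1 := hφ.image_mem_nhdsWithin hv hKv
  obtain ⟨r, hr, hrK⟩ := Metric.mem_nhdsWithin_iff.1 h1
  refine ⟨r, hr, ?_⟩
  rintro y ⟨hyM, hyr⟩
  have h2 : y ∈ closure (Metric.ball (φ v) r ∩ M) :=
    Metric.isOpen_ball.inter_closure ⟨hyr, hyM⟩
  have h3 : Metric.ball (φ v) r ∩ M ⊆ φ '' K :=
    hrK.trans (Set.image_mono Set.inter_subset_left)
  obtain ⟨x, hx, rfl⟩ := closure_minimal h3 hKim.isClosed h2
  exact hφ.mapsTo (hKV hx)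

/-- A strictly differentiable family in `M` whose derivative covers the tangent space is open. -/
theorem HasTangentSpaceAt.image_mem_nhdsWithin {m : ℕ} {M : Set 𝓗} {p : 𝓗}
    {T : Submodule ℝ 𝓗} (h : HasTangentSpaceAt m M p T) {W : Type*} [NormedAddCommGroup W]
    [NormedSpace ℝ W] [FiniteDimensional ℝ W] {f : W → 𝓗} {f' : W →L[ℝ] 𝓗} {w : W}
    (hf : HasStrictFDerivAt f f' w) (hp : f w = p) (hM : ∀ᶠ x in 𝓝 w, f x ∈ M)
    (hT : ∀ y ∈ T, ∃ x, f' x = y) {N : Set W} (hN : N ∈ 𝓝 w) : f '' N ∈ 𝓝[M] p := by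
  have := FiniteDimensional.complete ℝ W
  obtain ⟨V, φ, hφ, v, hv, hφv, rfl⟩ := h
  have hφd : HasStrictFDerivAt φ (fderiv ℝ φ v) v :=
    (hφ.smooth.contDiffAt (hφ.isOpen.mem_nhds hv)).hasStrictFDerivAt (by simp)
  -- Composition with `P` moves the problem to `ℝᵐ`, where it is solved by the open mapping property
  -- of strict derivatives.
  obtain ⟨P, hP⟩ := exists_clm_leftInverse (fderiv ℝ φ v) (hφ.immersion v hv)
  have hPφ : HasStrictFDerivAt (fun x => P (φ x))
      ((ContinuousLinearEquiv.refl ℝ (EuclideanSpace ℝ (Fin m)) :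
        EuclideanSpace ℝ (Fin m) ≃L[ℝ] EuclideanSpace ℝ (Fin m)) :
        EuclideanSpace ℝ (Fin m) →L[ℝ] EuclideanSpace ℝ (Fin m)) v := by
    have := P.hasStrictFDerivAt.comp v hφd
    rw [hP] at this
    exact this
  let e := hPφ.toOpenPartialHomeomorph (fun x => P (φ x))
  have hinj : Set.InjOn (fun x => P (φ x)) e.source := e.injOn
  have hsrc : e.source ∈ 𝓝 v :=
    e.open_source.mem_nhds hPφ.mem_toOpenPartialHomeomorph_source
  have hchart := hφ.image_mem_nhdsWithin hv hsrc
  rw [hφv] at hchart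
  have hPf : HasStrictFDerivAt (fun x => P (f x)) (P.comp f') w := P.hasStrictFDerivAt.comp w hf
  have hsurj : (P.comp f').range = ⊤ := by
    rw [LinearMap.range_eq_top]
    intro y
    obtain ⟨x, hx⟩ := hT (fderiv ℝ φ v y) ⟨y, rfl⟩
    refine ⟨x, ?_⟩
    have := congrArg (fun A => A y) hP
    simpa [hx] using this
  have hmap := hPf.map_nhds_eq_of_surj hsurj
  rw [hp] at hmap
  have hfN : ∀ᶠ x in 𝓝 w, f x ∈ φ '' (e.source ∩ V) := by
    have h1 : Tendsto f (𝓝 w) (𝓝[M] p) := by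
      rw [tendsto_nhdsWithin_iff]
      exact ⟨hp ▸ hf.continuousAt, hM⟩
    exact h1 hchart
  have hN' : N ∩ {x | f x ∈ φ '' (e.source ∩ V)} ∈ 𝓝 w := inter_mem hN hfN
  have himg : (fun x => P (f x)) '' (N ∩ {x | f x ∈ φ '' (e.source ∩ V)}) ∈ 𝓝 (P p) := by
    rw [← hmap]
    exact image_mem_map hN'
  have hpre : P ⁻¹' ((fun x => P (f x)) '' (N ∩ {x | f x ∈ φ '' (e.source ∩ V)})) ∈ 𝓝[M] p :=
    nhdsWithin_le_nhds (P.continuous.continuousAt himg)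
  filter_upwards [hchart, hpre] with y hy hy'
  obtain ⟨x, ⟨hxN, z', hz', hzx⟩, hxy⟩ := hy'
  obtain ⟨z, hz, rfl⟩ := hy
  -- `y` and `f x` lie in the same chart and have the same image under `P`, which is injective
  -- there.
  have hzz : z = z' := by
    apply hinj hz.1 hz'.1
    simp only
    rw [hzx]
    exact hxy.symm
  exact ⟨x, hxN, by rw [← hzx, hzz]⟩

theorem HasTangentSpaceAt.finrank_eq {m : ℕ} {M : Set 𝓗} {p : 𝓗}
    {T : Submodule ℝ 𝓗} (h : HasTangentSpaceAt m M p T) :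
    FiniteDimensional ℝ T ∧ Module.finrank ℝ T = m := by
  obtain ⟨V, φ, hφ, v, hv, -, rfl⟩ := h
  refine ⟨inferInstance, ?_⟩
  rw [LinearMap.finrank_range_of_inj (hφ.immersion v hv)]
  simp

end Manifold

end

section

variable {𝓗 : Type*} [NormedAddCommGroup 𝓗] [InnerProductSpace ℂ 𝓗]
variable {D : Submodule ℂ 𝓗} {r : ℕ} {H₀ : Module.End ℂ D} {Hc : Fin r → Module.End ℂ D}

/-! ### The Lie algebras of the control system -/

theorem isSkewHermitian_of_mem_lieL (hH₀ : IsSkewHermitian H₀) (hHc : ∀ l, IsSkewHermitian (Hc l))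
    {X : Module.End ℂ D} (hX : X ∈ lieL H₀ Hc) : IsSkewHermitian X := by
  let K : LieSubalgebra ℝ (Module.End ℂ D) :=
    { carrier := {X | IsSkewHermitian X}
      add_mem' := by
        intro X Y hX hY x y
        simp only [LinearMap.add_apply, Submodule.coe_add, inner_add_left, inner_add_right]
        rw [hX x y, hY x y]
        ring
      zero_mem' := by intro x y; simp
      smul_mem' := by
        intro c X hX x y
        have e : ∀ z : D, (((c • X) z : D) : 𝓗) = (c : ℂ) • ((X z : D) : 𝓗) := by
          intro z
          rw [Complex.coe_smul]; rfl
        rw [e, e, inner_smul_left, inner_smul_right, hX x y, Complex.conj_ofReal]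
        ring
      lie_mem' := by
        intro X Y hX hY x y
        simp only [LieRing.of_associative_ring_bracket, LinearMap.sub_apply, Module.End.mul_apply,
          Submodule.coe_sub, inner_sub_left, inner_sub_right]
        rw [hX (Y x) y, hY (X x) y, hY x (X y), hX x (Y y)]
        ring }
  have : lieL H₀ Hc ≤ K := by
    refine LieSubalgebra.lieSpan_le.2 ?_
    rintro X (rfl | ⟨l, rfl⟩)
    · exact hH₀
    · exact hHc l
  exact this hX

/-- The flows of the operators in `𝓛 {H₀, …, H_r}`. -/
def IsAnalyticDomain.flow (hH₀ : IsSkewHermitian H₀) (hHc : ∀ l, IsSkewHermitian (Hc l))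
    (hD : IsAnalyticDomain D H₀ Hc) : AnalyticFlow (lieL H₀ Hc) where
  dense := hD.dense
  skew := fun _ hX => isSkewHermitian_of_mem_lieL hH₀ hHc hX
  analytic := hD.analytic
  unitary := fun X => (hD.exponentiates X X.2).choose
  isExp := fun X => (hD.exponentiates X X.2).choose_spec

variable (H₀ Hc) in
theorem drift_mem_lieL : H₀ ∈ lieL H₀ Hc := LieSubalgebra.subset_lieSpan (Or.inl rfl)

variable (H₀ Hc) in
theorem control_mem_lieL (l : Fin r) : Hc l ∈ lieL H₀ Hc :=
  LieSubalgebra.subset_lieSpan (Or.inr ⟨l, rfl⟩)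

variable (Hc) in
theorem control_mem_lieB (l : Fin r) : Hc l ∈ lieB Hc := LieSubalgebra.subset_lieSpan ⟨l, rfl⟩

variable (H₀ Hc) in
theorem ad_pow_mem_lieC (n : ℕ) {X : Module.End ℂ D} (hX : X ∈ lieB Hc) :
    (LieAlgebra.ad ℝ (Module.End ℂ D) H₀ ^ n) X ∈ lieC H₀ Hc :=
  LieSubalgebra.subset_lieSpan (Set.mem_iUnion.2 ⟨n, X, hX, rfl⟩)

variable (H₀ Hc) in
theorem lieB_le_lieC : lieB Hc ≤ lieC H₀ Hc := fun _ hX => by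
  have := ad_pow_mem_lieC H₀ Hc 0 hX
  simpa using this

/-- A Lie subalgebra that contains `𝓑` and all `ad_{H₀}ⁿ 𝓑` contains `𝓒`. -/
theorem lieC_le {K : LieSubalgebra ℝ (Module.End ℂ D)}
    (hK : ∀ (n : ℕ), ∀ X ∈ lieB Hc, (LieAlgebra.ad ℝ (Module.End ℂ D) H₀ ^ n) X ∈ K) :
    lieC H₀ Hc ≤ K := by
  refine LieSubalgebra.lieSpan_le.2 ?_
  intro Y hY
  obtain ⟨n, X, hX, rfl⟩ := Set.mem_iUnion.1 hY
  exact hK n X hX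

variable (H₀ Hc) in
theorem lieB_le_lieL : lieB Hc ≤ lieL H₀ Hc := LieSubalgebra.lieSpan_mono fun _ h => Or.inr h

theorem ad_pow_succ_apply (n : ℕ) (X : Module.End ℂ D) :
    (LieAlgebra.ad ℝ (Module.End ℂ D) H₀ ^ (n + 1)) X =
      ⁅H₀, (LieAlgebra.ad ℝ (Module.End ℂ D) H₀ ^ n) X⁆ := by
  rw [pow_succ']; rfl

/-- A submodule stable under `ad H₀` that contains `𝓑` contains all `ad_{H₀}ⁿ 𝓑`. -/
theorem ad_pow_mem_of_stable {S : Submodule ℝ (Module.End ℂ D)} (hB : ∀ X ∈ lieB Hc, X ∈ S)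
    (hS : ∀ X ∈ S, ⁅H₀, X⁆ ∈ S) (n : ℕ) {X : Module.End ℂ D} (hX : X ∈ lieB Hc) :
    (LieAlgebra.ad ℝ (Module.End ℂ D) H₀ ^ n) X ∈ S := by
  induction n with
  | zero => simpa using hB X hX
  | succ n ih => rw [ad_pow_succ_apply]; exact hS _ ih

variable (H₀ Hc) in
theorem lieC_le_lieL : lieC H₀ Hc ≤ lieL H₀ Hc :=
  lieC_le fun n _ hX => ad_pow_mem_of_stable (S := (lieL H₀ Hc).toSubmodule)
    (fun _ h => lieB_le_lieL H₀ Hc h)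
    (fun _ h => (lieL H₀ Hc).lie_mem (drift_mem_lieL H₀ Hc) h) n hX

/-- The Lie subalgebra of operators that normalize a submodule. -/
def submoduleNormalizer (S : Submodule ℝ (Module.End ℂ D)) :
    LieSubalgebra ℝ (Module.End ℂ D) where
  carrier := {X | ∀ Y ∈ S, ⁅X, Y⁆ ∈ S}
  add_mem' := by
    intro X Z hX hZ Y hY
    rw [add_lie]
    exact S.add_mem (hX Y hY) (hZ Y hY)
  zero_mem' := by intro Y _; simp
  smul_mem' := by
    intro c X hX Y hY
    have : ⁅c • X, Y⁆ = c • ⁅X, Y⁆ := by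
      simp [LieRing.of_associative_ring_bracket, smul_sub]
    rw [this]
    exact S.smul_mem c (hX Y hY)
  lie_mem' := by
    intro X Z hX hZ Y hY
    rw [lie_lie]
    exact S.sub_mem (hX _ (hZ Y hY)) (hZ _ (hX Y hY))

theorem lie_mem_of_generators {S : Submodule ℝ (Module.End ℂ D)}
    (h₀ : ∀ Y ∈ S, ⁅H₀, Y⁆ ∈ S) (hc : ∀ l, ∀ Y ∈ S, ⁅Hc l, Y⁆ ∈ S)
    {X : Module.End ℂ D} (hX : X ∈ lieL H₀ Hc) {Y : Module.End ℂ D} (hY : Y ∈ S) :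
    ⁅X, Y⁆ ∈ S := by
  have : lieL H₀ Hc ≤ submoduleNormalizer S := by
    refine LieSubalgebra.lieSpan_le.2 ?_
    rintro X (rfl | ⟨l, rfl⟩)
    · exact h₀
    · exact hc l
  exact this hX Y hY

/-- `𝓒` is an ideal of `𝓛 {H₀, …, H_r}`. -/
theorem lie_mem_lieC {X Y : Module.End ℂ D} (hX : X ∈ lieL H₀ Hc) (hY : Y ∈ lieC H₀ Hc) :
    ⁅X, Y⁆ ∈ lieC H₀ Hc := by
  -- By the Leibniz rule it is enough to check stability under `ad H₀` on the generators of `𝓒`,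
  -- where it only raises the exponent.
  let K : LieSubalgebra ℝ (Module.End ℂ D) :=
    { carrier := {Z | Z ∈ lieC H₀ Hc ∧ ⁅H₀, Z⁆ ∈ lieC H₀ Hc}
      add_mem' := by
        intro X Y hX hY
        exact ⟨add_mem hX.1 hY.1, by rw [lie_add]; exact add_mem hX.2 hY.2⟩
      zero_mem' := ⟨zero_mem _, by rw [lie_zero]; exact zero_mem _⟩
      smul_mem' := by
        intro c X hX
        refine ⟨(lieC H₀ Hc).smul_mem c hX.1, ?_⟩
        have : ⁅H₀, c • X⁆ = c • ⁅H₀, X⁆ := by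
          simp [LieRing.of_associative_ring_bracket, smul_sub]
        rw [this]
        exact (lieC H₀ Hc).smul_mem c hX.2
      lie_mem' := by
        intro X Y hX hY
        refine ⟨(lieC H₀ Hc).lie_mem hX.1 hY.1, ?_⟩
        rw [leibniz_lie]
        exact add_mem ((lieC H₀ Hc).lie_mem hX.2 hY.1) ((lieC H₀ Hc).lie_mem hX.1 hY.2) }
  have hK : lieC H₀ Hc ≤ K := lieC_le fun n Z hZ =>
    ⟨ad_pow_mem_lieC H₀ Hc n hZ, by
      rw [← ad_pow_succ_apply]; exact ad_pow_mem_lieC H₀ Hc (n + 1) hZ⟩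
  refine lie_mem_of_generators (S := (lieC H₀ Hc).toSubmodule) (fun Z hZ => (hK hZ).2)
    (fun l Z hZ => (lieC H₀ Hc).lie_mem (lieB_le_lieC H₀ Hc (control_mem_lieB Hc l)) hZ) hX hY

theorem control_comb_mem (c : Fin r → ℝ) {K : LieSubalgebra ℝ (Module.End ℂ D)}
    (hK : ∀ l, Hc l ∈ K) : ∑ l, c l • Hc l ∈ K :=
  K.toSubmodule.sum_mem fun l _ => K.smul_mem _ (hK l)

/-! ### Solutions for piecewise constant controls -/

variable (H₀ Hc) in
/-- The generator `H₀ + ∑ₗ cₗ Hₗ` of the motion with constant controls. -/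
def controlled (c : Fin r → ℝ) : lieL H₀ Hc :=
  ⟨H₀ + ∑ l, c l • Hc l,
    add_mem (drift_mem_lieL H₀ Hc) (control_comb_mem c (control_mem_lieL H₀ Hc))⟩

/-- `IsForward F T w`: the unitary `w` is a product of the flows of constant controls, for a
total time `T`. -/
inductive IsForward (F : AnalyticFlow (lieL H₀ Hc)) : ℝ → domainGroup D → Prop
  | one : IsForward F 0 1
  | step {T : ℝ} {w : domainGroup D} (c : Fin r → ℝ) {t : ℝ} (ht : 0 ≤ t) (h : IsForward F T w) :
      IsForward F (T + t) (F.U (controlled H₀ Hc c) t * w)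

variable {F : AnalyticFlow (lieL H₀ Hc)}

theorem IsForward.nonneg {T : ℝ} {w : domainGroup D} (h : IsForward F T w) : 0 ≤ T := by
  induction h with
  | one => exact le_rfl
  | step c ht h ih => linarith

theorem IsForward.mul {T T' : ℝ} {w w' : domainGroup D} (h : IsForward F T w)
    (h' : IsForward F T' w') : IsForward F (T + T') (w * w') := by
  induction h with
  | one => simpa using h'
  | @step T w c t ht h ih =>
    have := IsForward.step c ht ih
    rwa [← mul_assoc, show T + T' + t = T + t + T' by ring] at this

theorem isForward_U (F : AnalyticFlow (lieL H₀ Hc)) (c : Fin r → ℝ) {t : ℝ} (ht : 0 ≤ t) :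
    IsForward F t (F.U (controlled H₀ Hc c) t) := by
  have := IsForward.step (F := F) c ht IsForward.one
  simpa using this

theorem isForward_drift (F : AnalyticFlow (lieL H₀ Hc)) {t : ℝ} (ht : 0 ≤ t) :
    IsForward F t (F.U ⟨H₀, drift_mem_lieL H₀ Hc⟩ t) := by
  have := isForward_U F 0 ht
  have e : controlled H₀ Hc 0 = ⟨H₀, drift_mem_lieL H₀ Hc⟩ := by
    apply Subtype.ext
    simp [controlled]
  rwa [e] at this

theorem IsSolution.extend {t₀ t₁ : ℝ} {u : ℝ → Fin r → ℝ} {ψ : ℝ → D} (F : AnalyticFlow (lieL H₀ Hc))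
    (h : IsSolution H₀ Hc t₀ t₁ u ψ) (h01 : t₀ ≤ t₁) (c : Fin r → ℝ) {t : ℝ} (ht : 0 ≤ t) :
    ∃ u' ψ', IsSolution H₀ Hc t₀ (t₁ + t) u' ψ' ∧ ψ' t₀ = ψ t₀ ∧
      ψ' (t₁ + t) = dom (F.U (controlled H₀ Hc c) t) (ψ t₁) := by
  obtain ⟨hcont, n, τ, d, hmono, hτ0, hτn, hsol⟩ := h
  set X := controlled H₀ Hc c with hX
  set ψ' : ℝ → D := fun s => if s ≤ t₁ then ψ s else dom (F.U X (s - t₁)) (ψ t₁) with hψ'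
  have hψ'le : ∀ s, s ≤ t₁ → ψ' s = ψ s := fun s hs => by simp [hψ', hs]
  have hψ'ge : ∀ s, t₁ ≤ s → ψ' s = dom (F.U X (s - t₁)) (ψ t₁) := by
    intro s hs
    rcases hs.eq_or_lt with rfl | hs
    · simp [hψ']
    · simp [hψ', not_le.2 hs]
  -- Strict at `t₁` for the control, because controls are constant on intervals closed on the left;
  -- for the curve both prescriptions agree at `t₁`.
  refine ⟨fun s => if s < t₁ then u s else c, ψ', ⟨?_, n + 1,
    fun k => if k ≤ n then τ k else t₁ + t, fun k => if k < n then d k else c, ?_, ?_, ?_, ?_⟩,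
    hψ'le _ h01, ?_⟩
  · have hun : Set.Icc t₀ (t₁ + t) = Set.Icc t₀ t₁ ∪ Set.Icc t₁ (t₁ + t) :=
      (Set.Icc_union_Icc_eq_Icc h01 (by linarith)).symm
    rw [hun]
    refine ContinuousOn.union_of_isClosed ?_ ?_ isClosed_Icc isClosed_Icc
    · exact hcont.congr fun s hs => hψ'le s hs.2
    · refine ContinuousOn.congr (Continuous.continuousOn ?_) fun s hs => hψ'ge s hs.1
      refine Continuous.subtype_mk ?_ _
      exact (F.continuous_U X (ψ t₁)).comp (continuous_id.sub continuous_const)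
  · refine monotone_nat_of_le_succ fun k => ?_
    rcases lt_trichotomy k n with hk | rfl | hk
    · simp only [hk.le, Nat.succ_le_of_lt hk, if_true]
      exact hmono (Nat.le_succ k)
    · simp [hτn, ht]
    · simp [not_le.2 hk, not_le.2 (hk.trans (Nat.lt_succ_self k))]
  · simp [hτ0]
  · simp
  · intro k hk
    rcases (Nat.lt_succ_iff.1 hk).lt_or_eq with hkn | rfl
    · have hle : τ (k + 1) ≤ t₁ := hτn ▸ hmono hkn
      simp only [hkn.le, Nat.succ_le_of_lt hkn, hkn, if_true]
      obtain ⟨hu, hd⟩ := hsol k hkn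
      refine ⟨fun s hs => ?_, fun s hs => ?_⟩
      · rw [if_pos (hs.2.trans_le hle)]
        exact hu s hs
      · have hs1 : s < t₁ := hs.2.trans_le hle
        rw [if_pos hs1, hψ'le s hs1.le]
        refine (hd s hs).congr_of_eventuallyEq ?_
        filter_upwards [gt_mem_nhds hs1] with z hz
        rw [hψ'le z hz.le]
    · simp only [le_refl, if_true, lt_irrefl, if_false, hτn, Nat.not_succ_le_self]
      refine ⟨fun s hs => if_neg (not_lt.2 hs.1), fun s hs => ?_⟩
      rw [if_neg (not_lt.2 hs.1.le), hψ'ge s hs.1.le]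
      have h1 := HasDerivAt.scomp s (F.hasDerivAt_U X (ψ t₁) (s - t₁))
        ((hasDerivAt_id s).sub_const t₁)
      rw [one_smul] at h1
      refine h1.congr_of_eventuallyEq ?_
      filter_upwards [lt_mem_nhds hs.1] with z hz
      rw [hψ'ge z hz.le]
      rfl
  · rw [hψ'ge _ (by linarith)]
    simp

theorem IsForward.exists_solution {T : ℝ} {w : domainGroup D} (h : IsForward F T w) (t₀ : ℝ)
    (x : D) : ∃ u ψ, IsSolution H₀ Hc t₀ (t₀ + T) u ψ ∧ ψ t₀ = x ∧ ψ (t₀ + T) = dom w x := by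
  induction h with
  | one =>
    refine ⟨fun _ _ => 0, fun _ => x, ⟨continuousOn_const, 0, fun _ => t₀, fun _ _ => 0,
      monotone_const, rfl, by simp, by simp⟩, rfl, by simp⟩
  | @step T w c t ht h ih =>
    obtain ⟨u, ψ, hs, h0, h1⟩ := ih
    obtain ⟨u', ψ', hs', h0', h1'⟩ := hs.extend F (by linarith [h.nonneg]) c ht
    refine ⟨u', ψ', by rwa [← add_assoc], h0'.trans h0, ?_⟩
    rw [← add_assoc, h1', h1, dom_mul_apply]

variable {m : ℕ} {M : Set 𝓗}

theorem IsForward.mem_reachableSet (hM : IsStateManifold H₀ Hc m M) {T : ℝ} {w : domainGroup D}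
    (h : IsForward F T w) (t₀ : ℝ) {x : D} (hx : (x : 𝓗) ∈ M) :
    ((dom w x : D) : 𝓗) ∈ reachableSet H₀ Hc M t₀ (t₀ + T) x := by
  obtain ⟨u, ψ, hs, h0, h1⟩ := h.exists_solution t₀ x
  exact ⟨u, ψ, hs, hM.invariant _ _ u ψ hs (by rwa [h0]), by rw [h0], by rw [h1]⟩

theorem IsForward.mem (hM : IsStateManifold H₀ Hc m M) {T : ℝ} {w : domainGroup D}
    (h : IsForward F T w) {x : D} (hx : (x : 𝓗) ∈ M) : ((dom w x : D) : 𝓗) ∈ M := by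
  obtain ⟨u, ψ, hs, hmem, -, h1⟩ := h.mem_reachableSet hM 0 hx
  rw [← h1]
  exact hmem _ ⟨by linarith [h.nonneg], le_rfl⟩

end

section

variable {𝓗 : Type*} [NormedAddCommGroup 𝓗] [InnerProductSpace ℂ 𝓗] [CompleteSpace 𝓗]
variable {D : Submodule ℂ 𝓗} {r : ℕ} {H₀ : Module.End ℂ D} {Hc : Fin r → Module.End ℂ D}

/-! ### Limits of reachable states -/

variable (H₀ Hc) in
/-- The drift operator as an element of `𝓛 {H₀, …, H_r}`. -/
def drift : lieL H₀ Hc := ⟨H₀, drift_mem_lieL H₀ Hc⟩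

variable (F : AnalyticFlow (lieL H₀ Hc))

/-- The limits of states that are reachable from `x` at times slightly later than `T`. -/
def limitReach (T : ℝ) (x : D) : Set 𝓗 :=
  {q | ∀ ε > 0, ∃ T' w, T ≤ T' ∧ T' < T + ε ∧ IsForward F T' w ∧ ‖((dom w x : D) : 𝓗) - q‖ < ε}

omit [CompleteSpace 𝓗] in
theorem isClosed_limitReach (T : ℝ) (x : D) : IsClosed (limitReach F T x) := by
  refine isClosed_of_closure_subset fun q hq ε hε => ?_
  obtain ⟨q', hq', hd⟩ := Metric.mem_closure_iff.1 hq (ε / 2) (half_pos hε)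
  obtain ⟨T', w, h1, h2, h3, h4⟩ := hq' (ε / 2) (half_pos hε)
  refine ⟨T', w, h1, by linarith, h3, ?_⟩
  rw [dist_eq_norm] at hd
  have := norm_sub_le_norm_sub_add_norm_sub ((dom w x : D) : 𝓗) q' q
  rw [norm_sub_rev q' q] at this
  linarith

omit [CompleteSpace 𝓗] in
theorem self_mem_limitReach (x : D) : (x : 𝓗) ∈ limitReach F 0 x := fun ε hε =>
  ⟨0, 1, le_rfl, by simpa using hε, IsForward.one, by simpa using hε⟩

variable {F}

omit [CompleteSpace 𝓗] in
theorem drift_mem_limitReach {T : ℝ} {x : D} {q : 𝓗} (hq : q ∈ limitReach F T x) {s : ℝ}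
    (hs : 0 ≤ s) : (F.U (drift H₀ Hc) s : 𝓗 ≃ₗᵢ[ℂ] 𝓗) q ∈ limitReach F (T + s) x := by
  intro ε hε
  obtain ⟨T', w, h1, h2, h3, h4⟩ := hq ε hε
  refine ⟨s + T', F.U (drift H₀ Hc) s * w, by linarith, by linarith, (isForward_drift F hs).mul h3, ?_⟩
  rw [dom_mul_apply, coe_dom, ← map_sub, LinearIsometryEquiv.norm_map]
  exact h4

/-- A control of size `t / δ` for a time `δ` generates `t H_l + δ H₀`, whose flow at time 1 tends to
that of `t H_l`. The sign of `t` is free, and the time `δ` spent is why `limitReach` admits times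
slightly after `T`. -/
theorem preserves_control_limitReach (T : ℝ) (x : D) (l : Fin r) :
    F.Preserves ⟨Hc l, control_mem_lieL H₀ Hc l⟩ (limitReach F T x) := by
  intro t q hq ε hε
  obtain ⟨T', w, h1, h2, h3, h4⟩ := hq (ε / 2) (half_pos hε)
  set Y : lieL H₀ Hc := ⟨Hc l, control_mem_lieL H₀ Hc l⟩ with hY
  have hU : ∀ z : 𝓗, (F.U Y t : 𝓗 ≃ₗᵢ[ℂ] 𝓗) z = (F.U (t • Y) 1 : 𝓗 ≃ₗᵢ[ℂ] 𝓗) z := by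
    intro z; rw [F.U_smul, mul_one]
  have htend := F.tendsto_U_add_smul (t • Y) (drift H₀ Hc) (dom w x)
  have hev := (tendsto_iff_norm_sub_tendsto_zero.1 htend).eventually (gt_mem_nhds (half_pos hε))
  have hsmall : ∀ᶠ δ in 𝓝[>] (0 : ℝ), δ < ε / 2 :=
    nhdsWithin_le_nhds (gt_mem_nhds (half_pos hε))
  obtain ⟨δ, ⟨hδ1, hδ2⟩, hδ0⟩ := ((hev.and hsmall).and self_mem_nhdsWithin).exists
  have hδ0' : 0 < δ := hδ0
  have hgen : t • Y + δ • drift H₀ Hc = δ • controlled H₀ Hc (Pi.single l (t / δ)) := by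
    apply Subtype.ext
    have : ∑ k, (Pi.single l (t / δ) : Fin r → ℝ) k • Hc k = (t / δ) • Hc l := by
      rw [Finset.sum_eq_single l]
      · simp
      · intro k _ hk; simp [hk]
      · simp
    change t • Hc l + δ • H₀ = δ • (H₀ + ∑ k, (Pi.single l (t / δ) : Fin r → ℝ) k • Hc k)
    rw [this, smul_add, smul_smul, mul_div_cancel₀ _ hδ0'.ne', add_comm]
  rw [hgen, F.U_smul, mul_one] at hδ1
  refine ⟨δ + T', F.U (controlled H₀ Hc (Pi.single l (t / δ))) δ * w, by linarith, by linarith,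
    (isForward_U F _ hδ0'.le).mul h3, ?_⟩
  rw [dom_mul_apply, coe_dom, hU]
  have e1 := norm_sub_le_norm_sub_add_norm_sub
    ((F.U (controlled H₀ Hc (Pi.single l (t / δ))) δ : 𝓗 ≃ₗᵢ[ℂ] 𝓗) ((dom w x : D) : 𝓗))
    ((F.U (t • Y) 1 : 𝓗 ≃ₗᵢ[ℂ] 𝓗) ((dom w x : D) : 𝓗)) ((F.U (t • Y) 1 : 𝓗 ≃ₗᵢ[ℂ] 𝓗) q)
  rw [← map_sub (F.U (t • Y) 1 : 𝓗 ≃ₗᵢ[ℂ] 𝓗), LinearIsometryEquiv.norm_map] at e1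
  linarith

theorem lieB_le_stabilizer_limitReach (T : ℝ) (x : D) :
    lieB Hc ≤ F.stabilizer (limitReach F T x) (isClosed_limitReach F T x) := by
  refine LieSubalgebra.lieSpan_le.2 ?_
  rintro X ⟨l, rfl⟩
  exact ⟨control_mem_lieL H₀ Hc l, preserves_control_limitReach T x l⟩

/-! ### Impulsive motions -/

omit [CompleteSpace 𝓗] in
theorem U_mul_comm_conj (g : domainGroup D) (Y Z : lieL H₀ Hc)
    (h : (Z : Module.End ℂ D) = Ad g⁻¹ Y) (t : ℝ) : F.U Y t * g = g * F.U Z t := by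
  rw [F.U_conj g⁻¹ Y Z h]
  group

theorem Ad_U_mem_lieC {X : lieL H₀ Hc} {Y : Module.End ℂ D} (t : ℝ) (hY : Y ∈ lieC H₀ Hc) :
    Ad (F.U X t) Y ∈ lieC H₀ Hc :=
  F.Ad_U_mem X (S := (lieC H₀ Hc).toSubmodule) (lieC_le_lieL H₀ Hc)
    (fun _ h => lie_mem_lieC X.2 h) t hY

variable (F) in
/-- Products of drift motions for a total time `T` and of instantaneous motions generated
by `𝓑`. -/
inductive IsImpulsive : ℝ → domainGroup D → Prop
  | one : IsImpulsive 0 1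
  | drift {T : ℝ} {w : domainGroup D} {s : ℝ} (hs : 0 ≤ s) (h : IsImpulsive T w) :
      IsImpulsive (s + T) (F.U (drift H₀ Hc) s * w)
  | impulse {T : ℝ} {w : domainGroup D} {Y : lieL H₀ Hc} (hY : (Y : Module.End ℂ D) ∈ lieB Hc)
      (t : ℝ) (h : IsImpulsive T w) : IsImpulsive T (F.U Y t * w)

theorem IsImpulsive.mem_limitReach {T : ℝ} {w : domainGroup D} (h : IsImpulsive F T w) (x : D) :
    ((dom w x : D) : 𝓗) ∈ limitReach F T x := by
  induction h with
  | one => simpa using self_mem_limitReach F x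
  | @drift T w s hs h ih =>
    have := drift_mem_limitReach ih hs
    rwa [add_comm, ← coe_dom, ← dom_mul_apply] at this
  | @impulse T w Y hY t h ih =>
    obtain ⟨h1, h2⟩ := lieB_le_stabilizer_limitReach (F := F) T x hY
    have := h2 t _ ih
    rwa [← coe_dom, ← dom_mul_apply] at this

section Ideal

variable (hBC : ∀ X ∈ lieB Hc, ∀ Y ∈ lieC H₀ Hc, ⁅X, Y⁆ ∈ lieB Hc)
include hBC

theorem Ad_U_mem_lieB {X : lieL H₀ Hc} (hX : (X : Module.End ℂ D) ∈ lieC H₀ Hc) (t : ℝ)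
    {Y : Module.End ℂ D} (hY : Y ∈ lieB Hc) : Ad (F.U X t) Y ∈ lieB Hc := by
  refine F.Ad_U_mem X (S := (lieB Hc).toSubmodule) (lieB_le_lieL H₀ Hc) (fun Z hZ => ?_) t hY
  rw [← lie_skew]
  exact (lieB Hc).neg_mem (hBC Z hZ X hX)

/-- The flow of `Y` is an impulse given a time `σ` before the end, and it is moved back through the
factors of `w` to that instant, which exists since `σ ≤ T`. Passing a drift segment shortens `σ`.
Passing an impulse along `Y'` conjugates the direction by a flow of `Ad (U_{-σ}) Y' ∈ 𝓒`, and such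
flows preserve `𝓑`. -/
theorem IsImpulsive.insert {T : ℝ} {w : domainGroup D} (h : IsImpulsive F T w) {σ : ℝ}
    (h0 : 0 ≤ σ) (hσ : σ ≤ T) {Y : lieL H₀ Hc}
    (hY : Ad (F.U (QuantumControl.drift H₀ Hc) σ)⁻¹ (Y : Module.End ℂ D) ∈ lieB Hc) (t : ℝ) :
    IsImpulsive F T (F.U Y t * w) := by
  induction h generalizing σ Y with
  | one =>
    obtain rfl : σ = 0 := le_antisymm hσ h0
    exact IsImpulsive.impulse (by simpa using hY) t IsImpulsive.one
  | @drift T w s hs h ih =>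
    set d := QuantumControl.drift H₀ Hc
    -- If the instant falls within the current drift segment, the segment is split there.
    rcases le_or_gt σ s with hle | hlt
    · have hmem : Ad (F.U d σ)⁻¹ (Y : Module.End ℂ D) ∈ lieL H₀ Hc := lieB_le_lieL H₀ Hc hY
      have e : F.U Y t * (F.U d s * w) =
          F.U d σ * (F.U ⟨_, hmem⟩ t * (F.U d (s - σ) * w)) := by
        have e1 : F.U d s = F.U d σ * F.U d (s - σ) := by rw [← F.U_add]; simp
        rw [e1, ← mul_assoc, ← mul_assoc, U_mul_comm_conj (F.U d σ) Y ⟨_, hmem⟩ rfl]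
        simp only [mul_assoc]
      rw [e, show s + T = σ + ((s - σ) + T) by ring]
      exact IsImpulsive.drift h0 (IsImpulsive.impulse hY t (IsImpulsive.drift (by linarith) h))
    · have hmem : Ad (F.U d s)⁻¹ (Y : Module.End ℂ D) ∈ lieL H₀ Hc := by
        rw [← F.U_neg]; exact F.Ad_U_mem_L d _ Y.2
      rw [← mul_assoc, U_mul_comm_conj (F.U d s) Y ⟨_, hmem⟩ rfl, mul_assoc]
      refine IsImpulsive.drift hs (ih (σ := σ - s) (by linarith) (by linarith) ?_)
      have e1 : (F.U d σ)⁻¹ = (F.U d (σ - s))⁻¹ * (F.U d s)⁻¹ := by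
        rw [← mul_inv_rev, ← F.U_add]; simp
      rwa [e1, Ad_mul] at hY
  | @impulse T w Y' hY' t' h ih =>
    set d := QuantumControl.drift H₀ Hc
    have hmem : Ad (F.U Y' t')⁻¹ (Y : Module.End ℂ D) ∈ lieL H₀ Hc := by
      rw [← F.U_neg]; exact F.Ad_U_mem_L Y' _ Y.2
    rw [← mul_assoc, U_mul_comm_conj (F.U Y' t') Y ⟨_, hmem⟩ rfl, mul_assoc]
    refine IsImpulsive.impulse hY' t' (ih h0 hσ ?_)
    have hC : Ad (F.U d σ)⁻¹ (Y' : Module.End ℂ D) ∈ lieC H₀ Hc := by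
      rw [← F.U_neg]; exact Ad_U_mem_lieC _ (lieB_le_lieC H₀ Hc hY')
    have e : Ad (F.U d σ)⁻¹ (Ad (F.U Y' t')⁻¹ (Y : Module.End ℂ D)) =
        Ad (F.U ⟨_, lieC_le_lieL H₀ Hc hC⟩ (-t')) (Ad (F.U d σ)⁻¹ (Y : Module.End ℂ D)) := by
      rw [F.U_conj (F.U d σ)⁻¹ Y' ⟨_, lieC_le_lieL H₀ Hc hC⟩ rfl, ← Ad_mul, ← Ad_mul, F.U_neg]
      congr 1
      group
    change Ad (F.U d σ)⁻¹ (Ad (F.U Y' t')⁻¹ (Y : Module.End ℂ D)) ∈ lieB Hc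
    rw [e]
    exact Ad_U_mem_lieB hBC hC _ hY

/-- Insertion makes the set invariant under the flows of `Ad (U_σ) 𝓑` for `0 ≤ σ ≤ T`. Because the
stabilizer of its closure is a Lie algebra, differentiation in `σ` and brackets give all of `𝓒`. -/
theorem lieC_le_stabilizer_impulsive {T : ℝ} (hT : 0 < T) (x : D) :
    lieC H₀ Hc ≤ F.stabilizer
      (closure {q : 𝓗 | ∃ w, IsImpulsive F T w ∧ ((dom w x : D) : 𝓗) = q}) isClosed_closure := by
  set A : Set 𝓗 := {q : 𝓗 | ∃ w, IsImpulsive F T w ∧ ((dom w x : D) : 𝓗) = q}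
  set K := F.stabilizer (closure A) isClosed_closure with hK
  set d := drift H₀ Hc
  have hKL : ∀ Y ∈ K, Y ∈ lieL H₀ Hc := fun Y hY => hY.1
  have hsub : ∀ Y ∈ lieB Hc, ∀ σ, 0 ≤ σ → σ ≤ T → Ad (F.U d σ) Y ∈ K := by
    intro Y hY σ h0 hσ
    have hmem : Ad (F.U d σ) Y ∈ lieL H₀ Hc := F.Ad_U_mem_L d σ (lieB_le_lieL H₀ Hc hY)
    refine ⟨hmem, fun t q hq => ?_⟩
    have hmaps : Set.MapsTo (F.U ⟨_, hmem⟩ t : 𝓗 ≃ₗᵢ[ℂ] 𝓗) A A := by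
      rintro _ ⟨w, hw, rfl⟩
      exact ⟨F.U ⟨_, hmem⟩ t * w, hw.insert hBC h0 hσ
        ((Ad_inv_Ad (F.U d σ) Y).symm ▸ hY) t,
        by rw [dom_mul_apply]; rfl⟩
    exact hmaps.closure (LinearIsometryEquiv.continuous _) hq
  -- Membership is required on a whole interval of `σ`, not just at 0, so that a small drift keeps
  -- `Y` in `V` with the shorter interval `η - t`; this makes `V` stable under `ad H₀`.
  let V : Submodule ℝ (Module.End ℂ D) :=
    { carrier := {Y | ∃ η > 0, ∀ σ, 0 ≤ σ → σ < η → Ad (F.U d σ) Y ∈ K}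
      add_mem' := by
        rintro Y Z ⟨η, hη, h⟩ ⟨η', hη', h'⟩
        refine ⟨min η η', lt_min hη hη', fun σ h0 hσ => ?_⟩
        rw [map_add]
        exact K.add_mem (h σ h0 (hσ.trans_le (min_le_left _ _)))
          (h' σ h0 (hσ.trans_le (min_le_right _ _)))
      zero_mem' := ⟨1, one_pos, fun σ _ _ => by rw [map_zero]; exact K.zero_mem⟩
      smul_mem' := by
        rintro c Y ⟨η, hη, h⟩
        refine ⟨η, hη, fun σ h0 hσ => ?_⟩
        rw [map_smul]
        exact K.smul_mem c (h σ h0 hσ) }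
  have hVK : ∀ Y ∈ V, Y ∈ K := by
    rintro Y ⟨η, hη, h⟩
    simpa using h 0 le_rfl hη
  have hBV : ∀ Y ∈ lieB Hc, Y ∈ V := fun Y hY => ⟨T, hT, fun σ h0 hσ => hsub Y hY σ h0 hσ.le⟩
  have hVd : ∀ Y ∈ V, ⁅H₀, Y⁆ ∈ V := by
    intro Y hY
    have hYL := hKL Y (hVK Y hY)
    obtain ⟨η, hη, h⟩ := hY
    refine (F.mem_and_lie_mem_of_Ad_mem d hYL ?_).2
    filter_upwards [Ioo_mem_nhdsGT hη] with t ht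
    refine ⟨η - t, sub_pos.2 ht.2, fun σ h0 hσ => ?_⟩
    rw [← Ad_mul, ← F.U_add]
    exact h _ (by linarith [ht.1]) (by linarith)
  exact lieC_le fun n X hX => hVK _ (ad_pow_mem_of_stable hBV hVd n hX)

end Ideal

/-! ### The group generated by `𝓒` -/

variable (F) in
/-- The group of unitary operators generated by `𝓒`. -/
def groupC : Subgroup (domainGroup D) :=
  Subgroup.closure {g | ∃ (Y : lieL H₀ Hc) (t : ℝ), (Y : Module.End ℂ D) ∈ lieC H₀ Hc ∧ g = F.U Y t}

omit [CompleteSpace 𝓗] in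
theorem U_mem_groupC {Y : lieL H₀ Hc} (hY : (Y : Module.End ℂ D) ∈ lieC H₀ Hc) (t : ℝ) :
    F.U Y t ∈ groupC F := Subgroup.subset_closure ⟨Y, t, hY, rfl⟩

omit [CompleteSpace 𝓗] in
theorem groupC_mapsTo {A : Set 𝓗} (h : ∀ Y : lieL H₀ Hc, (Y : Module.End ℂ D) ∈ lieC H₀ Hc →
    F.Preserves Y A) {g : domainGroup D} (hg : g ∈ groupC F) {a : 𝓗} (ha : a ∈ A) :
    (g : 𝓗 ≃ₗᵢ[ℂ] 𝓗) a ∈ A := by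
  let S : Subgroup (domainGroup D) :=
    { carrier := {g | ∀ a, (g : 𝓗 ≃ₗᵢ[ℂ] 𝓗) a ∈ A ↔ a ∈ A}
      mul_mem' := by
        intro g g' hg hg' a
        simp only [Subgroup.coe_mul, LinearIsometryEquiv.coe_mul, Function.comp_apply]
        rw [hg, hg']
      one_mem' := by intro a; simp
      inv_mem' := by
        intro g hg a
        rw [← hg]
        have : (g : 𝓗 ≃ₗᵢ[ℂ] 𝓗) (((g⁻¹ : domainGroup D) : 𝓗 ≃ₗᵢ[ℂ] 𝓗) a) = a :=
          (g : 𝓗 ≃ₗᵢ[ℂ] 𝓗).apply_symm_apply a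
        rw [this] }
  have hS : groupC F ≤ S := by
    refine (Subgroup.closure_le S).2 ?_
    rintro g ⟨Y, t, hY, rfl⟩ a
    refine ⟨fun ha => ?_, fun ha => h Y hY t a ha⟩
    have := h Y hY (-t) _ ha
    rw [F.U_neg] at this
    have e : (((F.U Y t)⁻¹ : domainGroup D) : 𝓗 ≃ₗᵢ[ℂ] 𝓗) ((F.U Y t : 𝓗 ≃ₗᵢ[ℂ] 𝓗) a) = a :=
      (F.U Y t : 𝓗 ≃ₗᵢ[ℂ] 𝓗).symm_apply_apply a
    rwa [e] at this
  exact (hS hg a).2 ha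

/-- The flows of `𝓛 {H₀, …, H_r}` normalize the group generated by `𝓒`. -/
theorem conj_mem_groupC {X : lieL H₀ Hc} (s : ℝ) {g : domainGroup D} (hg : g ∈ groupC F) :
    (F.U X s)⁻¹ * g * F.U X s ∈ groupC F := by
  have hS : groupC F ≤ (groupC F).comap (MulAut.conj (F.U X s)⁻¹).toMonoidHom := by
    refine (Subgroup.closure_le _).2 ?_
    rintro g ⟨Y, t, hY, rfl⟩
    have hC : Ad (F.U X s)⁻¹ (Y : Module.End ℂ D) ∈ lieC H₀ Hc := by
      rw [← F.U_neg]; exact Ad_U_mem_lieC _ hY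
    have := U_mem_groupC (F := F) (Y := ⟨_, lieC_le_lieL H₀ Hc hC⟩) hC t
    rw [F.U_conj (F.U X s)⁻¹ Y _ rfl] at this
    simpa using this
  simpa using hS hg

theorem IsForward.conj_mem_groupC {T : ℝ} {w : domainGroup D} (hw : IsForward F T w)
    {g : domainGroup D} (hg : g ∈ groupC F) : w⁻¹ * g * w ∈ groupC F := by
  induction hw generalizing g with
  | one => simpa using hg
  | @step T w c t ht h ih =>
    have := ih (QuantumControl.conj_mem_groupC (X := controlled H₀ Hc c) t hg)
    simpa [mul_assoc] using this

theorem groupC_drift_mem_limitReach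
    (hBC : ∀ X ∈ lieB Hc, ∀ Y ∈ lieC H₀ Hc, ⁅X, Y⁆ ∈ lieB Hc) {T : ℝ} (hT : 0 < T) (x : D)
    {g : domainGroup D} (hg : g ∈ groupC F) :
    ((dom g (dom (F.U (drift H₀ Hc) T) x) : D) : 𝓗) ∈ limitReach F T x := by
  have hsub : closure {q : 𝓗 | ∃ w, IsImpulsive F T w ∧ ((dom w x : D) : 𝓗) = q} ⊆
      limitReach F T x := by
    refine closure_minimal ?_ (isClosed_limitReach F T x)
    rintro _ ⟨w, hw, rfl⟩
    exact hw.mem_limitReach x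
  apply hsub
  refine groupC_mapsTo (fun Y hY => (lieC_le_stabilizer_impulsive hBC hT x hY).2) hg
    (subset_closure ⟨F.U (drift H₀ Hc) T, ?_, rfl⟩)
  have := IsImpulsive.drift (F := F) hT.le IsImpulsive.one
  simpa using this

/-! ### Invariance of the closure of `M` under the group -/

variable {m : ℕ} {M : Set 𝓗}

omit [CompleteSpace 𝓗] in
theorem limitReach_subset_closure (hM : IsStateManifold H₀ Hc m M) (T : ℝ) {x : D}
    (hx : (x : 𝓗) ∈ M) : limitReach F T x ⊆ closure M := by
  intro q hq
  refine Metric.mem_closure_iff.2 fun ε hε => ?_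
  obtain ⟨T', w, -, -, h3, h4⟩ := hq ε hε
  exact ⟨_, h3.mem hM hx, by rwa [dist_comm, dist_eq_norm]⟩

/-- For `x ∈ M ∩ D` the flow applied to `U_T x` is a limit of reachable states, hence in `closure
M`; now let `T` tend to 0. -/
theorem preserves_closure_manifold (hM : IsStateManifold H₀ Hc m M)
    (hBC : ∀ X ∈ lieB Hc, ∀ Y ∈ lieC H₀ Hc, ⁅X, Y⁆ ∈ lieB Hc) {Y : lieL H₀ Hc}
    (hY : (Y : Module.End ℂ D) ∈ lieC H₀ Hc) : F.Preserves Y (closure M) := by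
  intro t q hq
  have hcl : IsClosed {q : 𝓗 | (F.U Y t : 𝓗 ≃ₗᵢ[ℂ] 𝓗) q ∈ closure M} :=
    isClosed_closure.preimage (F.U Y t : 𝓗 ≃ₗᵢ[ℂ] 𝓗).continuous
  have hsub : M ∩ D ⊆ {q : 𝓗 | (F.U Y t : 𝓗 ≃ₗᵢ[ℂ] 𝓗) q ∈ closure M} := by
    rintro x ⟨hx, hxD⟩
    have hev : ∀ T > 0, (F.U Y t : 𝓗 ≃ₗᵢ[ℂ] 𝓗) ((F.U (drift H₀ Hc) T : 𝓗 ≃ₗᵢ[ℂ] 𝓗) x)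
        ∈ closure M := fun T hT =>
      limitReach_subset_closure hM T (x := ⟨x, hxD⟩) hx
        (groupC_drift_mem_limitReach hBC hT ⟨x, hxD⟩ (U_mem_groupC hY t))
    have htend : Tendsto (fun T => (F.U Y t : 𝓗 ≃ₗᵢ[ℂ] 𝓗)
        ((F.U (drift H₀ Hc) T : 𝓗 ≃ₗᵢ[ℂ] 𝓗) x)) (𝓝[>] 0)
        (𝓝 ((F.U Y t : 𝓗 ≃ₗᵢ[ℂ] 𝓗) x)) := by
      have h1 : Continuous fun T => (F.U Y t : 𝓗 ≃ₗᵢ[ℂ] 𝓗)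
          ((F.U (drift H₀ Hc) T : 𝓗 ≃ₗᵢ[ℂ] 𝓗) x) :=
        (F.U Y t : 𝓗 ≃ₗᵢ[ℂ] 𝓗).continuous.comp (F.continuous_U _ x)
      have h2 := (h1.tendsto 0).mono_left (nhdsWithin_le_nhds (s := Set.Ioi 0))
      simpa using h2
    exact isClosed_closure.mem_of_tendsto htend (eventually_nhdsWithin_of_forall hev)
  have h1 : closure (M ∩ D) ⊆ {q : 𝓗 | (F.U Y t : 𝓗 ≃ₗᵢ[ℂ] 𝓗) q ∈ closure M} :=
    closure_minimal hsub hcl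
  exact h1 (closure_minimal hM.dense isClosed_closure hq)

end

section

variable {𝓗 : Type*} [NormedAddCommGroup 𝓗] [InnerProductSpace ℂ 𝓗] [CompleteSpace 𝓗]
variable {D : Submodule ℂ 𝓗}

/-! ### Finite-dimensional regular families through a state -/

section Families

variable {L : LieSubalgebra ℝ (Module.End ℂ D)} {F : AnalyticFlow L}

variable (F) in
/-- There is a finite-dimensional regular family of states with property `P` through `x`, whose
derivative covers `W`. -/
def HasRegularFamily (x : D) (P : D → Prop) (W : Submodule ℝ 𝓗) : Prop :=
  ∃ (V : Type) (_ : NormedAddCommGroup V) (_ : NormedSpace ℝ V) (_ : FiniteDimensional ℝ V)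
    (f : V → D) (f' : V →L[ℝ] 𝓗), F.IsRegularAt f f' 0 ∧ f 0 = x ∧ (∀ᶠ v in 𝓝 0, P (f v)) ∧
      ∀ y ∈ W, ∃ v, f' v = y

omit [CompleteSpace 𝓗] in
theorem hasRegularFamily_const {x : D} {P : D → Prop} (hP : P x) : HasRegularFamily F x P ⊥ :=
  ⟨PUnit, inferInstance, inferInstance, inferInstance, fun _ => x, 0, F.isRegularAt_const x 0, rfl,
    Eventually.of_forall fun _ => hP, fun y hy => ⟨0, by simpa using ((Submodule.mem_bot ℝ).1 hy).symm⟩⟩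

omit [CompleteSpace 𝓗] in
theorem HasRegularFamily.mono {x : D} {P : D → Prop} {W W' : Submodule ℝ 𝓗}
    (h : HasRegularFamily F x P W) (hW : W' ≤ W) : HasRegularFamily F x P W' := by
  obtain ⟨V, i1, i2, i3, f, f', h1, h2, h3, h4⟩ := h
  exact ⟨V, i1, i2, i3, f, f', h1, h2, h3, fun y hy => h4 y (hW hy)⟩

/-- A unitary operator, as a real linear map. -/
abbrev realMap (g : domainGroup D) : 𝓗 →ₗ[ℝ] 𝓗 :=
  (AnalyticFlow.realCLM (g : 𝓗 ≃ₗᵢ[ℂ] 𝓗) : 𝓗 →ₗ[ℝ] 𝓗)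

/-- Composing a regular family with two flows whose durations depend on a new parameter. -/
theorem HasRegularFamily.flow_flow {x : D} {P P' : D → Prop} {W : Submodule ℝ 𝓗}
    (h : HasRegularFamily F x P W) (Y Z : L) (s t p q : ℝ)
    (hP : ∀ᶠ a in 𝓝 (0 : ℝ), ∀ y, P y → P' (dom (F.U Z (t + q * a)) (dom (F.U Y (s + p * a)) y))) :
    HasRegularFamily F (dom (F.U Z t) (dom (F.U Y s) x)) P'
      (W.map (realMap (F.U Z t * F.U Y s)) ⊔ Submodule.span ℝ
        {p • ((dom (F.U Z t) ((Y : Module.End ℂ D) (dom (F.U Y s) x)) : D) : 𝓗) +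
          q • (((Z : Module.End ℂ D) (dom (F.U Z t) (dom (F.U Y s) x)) : D) : 𝓗)}) := by
  obtain ⟨V, i1, i2, i3, f, f', h1, h2, h3, h4⟩ := h
  have haff : ∀ c d : ℝ, HasStrictFDerivAt (fun v : V × ℝ => c + d * v.2)
      (d • ContinuousLinearMap.snd ℝ V ℝ) 0 := by
    intro c d
    exact ((ContinuousLinearMap.snd ℝ V ℝ).hasStrictFDerivAt.const_mul d).const_add c
  have g1 : F.IsRegularAt (fun v : V × ℝ => f v.1) (f'.comp (ContinuousLinearMap.fst ℝ V ℝ)) 0 :=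
    AnalyticFlow.IsRegularAt.comp_clm (ContinuousLinearMap.fst ℝ V ℝ) h1
  have g2 := g1.flow Y (haff s p)
  have g3 := g2.flow Z (haff t q)
  refine ⟨V × ℝ, inferInstance, inferInstance, inferInstance, _, _, g3, ?_, ?_, ?_⟩
  · simp [h2]
  · have e1 : ∀ᶠ v : V × ℝ in 𝓝 0, P (f v.1) :=
      (continuous_fst.tendsto (0 : V × ℝ)).eventually h3
    have e2 := (continuous_snd.tendsto (0 : V × ℝ)).eventually hP
    filter_upwards [e1, e2] with v hv1 hv2
    exact hv2 _ hv1
  · intro y hy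
    obtain ⟨y1, hy1, y2, hy2, rfl⟩ := Submodule.mem_sup.1 hy
    obtain ⟨y0, hy0, rfl⟩ := hy1
    obtain ⟨c, rfl⟩ := Submodule.mem_span_singleton.1 hy2
    obtain ⟨v, rfl⟩ := h4 y0 hy0
    refine ⟨(v, c), ?_⟩
    simp only [Prod.fst_zero, Prod.snd_zero, mul_zero, add_zero, h2]
    simp only [_root_.add_apply, ContinuousLinearMap.comp_apply, AnalyticFlow.realCLM_apply,
      ContinuousLinearMap.smulRight_apply, ContinuousLinearMap.coe_fst',
      ContinuousLinearMap.coe_snd', map_add, smul_apply, smul_eq_mul]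
    simp only [ContinuousLinearMap.coe_coe, AnalyticFlow.realCLM_apply, Subgroup.coe_mul,
      LinearIsometryEquiv.coe_mul, Function.comp_apply, smul_add, smul_smul, coe_dom, add_assoc]
    congr 2
    · rw [← AnalyticFlow.realCLM_apply, map_smul, mul_comm]; rfl
    · rw [mul_comm]

end Families

variable {r : ℕ} {H₀ : Module.End ℂ D} {Hc : Fin r → Module.End ℂ D}
variable {F : AnalyticFlow (lieL H₀ Hc)} {m : ℕ} {M : Set 𝓗}

omit [CompleteSpace 𝓗] in
/-- A regular family in the closure of `M` that covers the tangent space fills a neighbourhood. -/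
theorem HasRegularFamily.exists_ball (hM : IsStateManifold H₀ Hc m M) {x₀ x : D} {P : D → Prop}
    {W : Submodule ℝ 𝓗} (h : HasRegularFamily F x₀ P W) (g : domainGroup D) (hg : dom g x₀ = x)
    (hx : (x : 𝓗) ∈ M) (hP : ∀ y, P y → ((dom g y : D) : 𝓗) ∈ closure M)
    (hW : orbitSpace (lieL H₀ Hc) x ≤ W.map (realMap g)) :
    ∃ ρ > 0, ∀ y ∈ closure M, ‖y - x‖ < ρ → ∃ z, P z ∧ ((dom g z : D) : 𝓗) = y := by
  obtain ⟨V, i1, i2, i3, f, f', h1, h2, h3, h4⟩ := h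
  have hT := hM.tangent x hx
  obtain ⟨ρ, hρ, hball⟩ := hT.exists_ball_inter_closure_subset
  have hstrict : HasStrictFDerivAt (fun v => ((dom g (f v) : D) : 𝓗))
      ((AnalyticFlow.realCLM (g : 𝓗 ≃ₗᵢ[ℂ] 𝓗)).comp f') 0 :=
    (AnalyticFlow.realCLM (g : 𝓗 ≃ₗᵢ[ℂ] 𝓗)).hasStrictFDerivAt.comp 0 h1.strict
  have h0 : ((dom g (f 0) : D) : 𝓗) = x := by rw [h2, hg]
  -- `P` only places the family in `closure M`; local closedness of `M` near `x` places it in `M`.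
  have hfM : ∀ᶠ v in 𝓝 (0 : V), ((dom g (f v) : D) : 𝓗) ∈ M := by
    have e1 : ∀ᶠ v in 𝓝 (0 : V), ((dom g (f v) : D) : 𝓗) ∈ Metric.ball (x : 𝓗) ρ := by
      have := hstrict.continuousAt.tendsto
      rw [h0] at this
      exact this (Metric.ball_mem_nhds _ hρ)
    filter_upwards [e1, h3] with v hv hv'
    exact hball ⟨hP _ hv', hv⟩
  have himg := hT.image_mem_nhdsWithin hstrict h0 hfM (N := {v | P (f v)}) (fun y hy => by
    obtain ⟨z, hz, rfl⟩ := hW hy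
    obtain ⟨v, rfl⟩ := h4 z hz
    exact ⟨v, rfl⟩) h3
  obtain ⟨δ, hδ, hsub⟩ := Metric.mem_nhdsWithin_iff.1 himg
  refine ⟨min ρ δ, lt_min hρ hδ, fun y hy hyx => ?_⟩
  rw [← dist_eq_norm] at hyx
  have hyM : y ∈ M := hball ⟨hy, hyx.trans_le (min_le_left _ _)⟩
  obtain ⟨v, hv, rfl⟩ := hsub ⟨hyx.trans_le (min_le_right _ _), hyM⟩
  exact ⟨f v, hv, rfl⟩

omit [CompleteSpace 𝓗] in
theorem orbitSpace_lieL_eq (hM : IsStateManifold H₀ Hc m M)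
    (hdim : ∀ ψ : D, (ψ : 𝓗) ∈ M → Module.finrank ℝ (orbitSpace (lieC H₀ Hc) ψ) = m)
    {x : D} (hx : (x : 𝓗) ∈ M) : orbitSpace (lieL H₀ Hc) x = orbitSpace (lieC H₀ Hc) x := by
  obtain ⟨h1, h2⟩ := (hM.tangent x hx).finrank_eq
  symm
  refine Submodule.eq_of_le_of_finrank_eq (Submodule.map_mono (lieC_le_lieL H₀ Hc)) ?_
  rw [h2, hdim x hx]

theorem hasRegularFamily_groupC (x : D) :
    HasRegularFamily F x (fun y => ∃ g ∈ groupC F, y = dom g x) (orbitSpace (lieC H₀ Hc) x) := by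
  have := F.finiteDimensional
  have : FiniteDimensional ℝ (lieL H₀ Hc).toSubmodule := F.finiteDimensional
  have : FiniteDimensional ℝ (lieC H₀ Hc).toSubmodule :=
    Submodule.finiteDimensional_of_le (lieC_le_lieL H₀ Hc)
  obtain ⟨S, hS⟩ := (Submodule.fg_iff_finiteDimensional (lieC H₀ Hc).toSubmodule).2 inferInstance
  have key : ∀ S : Finset (Module.End ℂ D), (∀ Y ∈ S, Y ∈ lieC H₀ Hc) →
      HasRegularFamily F x (fun y => ∃ g ∈ groupC F, y = dom g x)
        ((Submodule.span ℝ (S : Set (Module.End ℂ D))).map (evalAt x)) := by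
    intro S
    classical
    induction S using Finset.induction_on with
    | empty =>
      intro _
      simpa using hasRegularFamily_const (F := F) (x := x)
        (P := fun y => ∃ g ∈ groupC F, y = dom g x) ⟨1, one_mem _, by simp⟩
    | insert Y S hYS ih =>
      intro h
      have hY := h Y (Finset.mem_insert_self Y S)
      -- One more factor, the flow of `Y` for a variable time around 0; the second flow allowed by
      -- `flow_flow` is trivial here.
      have h1 := (ih fun Z hZ => h Z (Finset.mem_insert_of_mem hZ)).flow_flow
        (P' := fun y => ∃ g ∈ groupC F, y = dom g x)
        (⟨Y, lieC_le_lieL H₀ Hc hY⟩ : lieL H₀ Hc) 0 0 0 1 0 (Eventually.of_forall fun a y hy => by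
          obtain ⟨g, hg, rfl⟩ := hy
          refine ⟨F.U ⟨Y, lieC_le_lieL H₀ Hc hY⟩ a * g,
            mul_mem (U_mem_groupC hY a) hg, ?_⟩
          simp)
      simp only [AnalyticFlow.U_zero, map_one, Module.End.one_apply] at h1
      refine h1.mono ?_
      rw [Finset.coe_insert, Submodule.span_insert, Submodule.map_sup, sup_comm]
      refine sup_le_sup ?_ ?_
      · intro z hz
        exact ⟨z, hz, by simp⟩
      · rw [Submodule.map_span, Set.image_singleton]
        simp [evalAt]
  have h := key S fun Y hY => hS.le (Submodule.subset_span hY)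
  rwa [hS] at h

/-! ### Transitivity on the closure of `M` and approximate steering -/

theorem exists_ball_orbit_groupC (hM : IsStateManifold H₀ Hc m M)
    (hdim : ∀ ψ : D, (ψ : 𝓗) ∈ M → Module.finrank ℝ (orbitSpace (lieC H₀ Hc) ψ) = m)
    (hBC : ∀ X ∈ lieB Hc, ∀ Y ∈ lieC H₀ Hc, ⁅X, Y⁆ ∈ lieB Hc) {x : D} (hx : (x : 𝓗) ∈ M) :
    ∃ ρ > 0, ∀ y ∈ closure M, ‖y - x‖ < ρ → ∃ g ∈ groupC F, ((dom g x : D) : 𝓗) = y := by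
  obtain ⟨ρ, hρ, h⟩ := (hasRegularFamily_groupC (F := F) x).exists_ball hM 1 (by simp) hx
    (fun y hy => by
      obtain ⟨g, hg, rfl⟩ := hy
      simp only [map_one, Module.End.one_apply]
      exact groupC_mapsTo (fun Y hY => preserves_closure_manifold hM hBC hY) hg (subset_closure hx))
    (by
      rw [orbitSpace_lieL_eq hM hdim hx]
      intro z hz
      exact ⟨z, hz, by simp⟩)
  refine ⟨ρ, hρ, fun y hy hyx => ?_⟩
  obtain ⟨z, ⟨g, hg, rfl⟩, hz⟩ := h y hy hyx
  exact ⟨g, hg, by simpa using hz⟩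

omit [CompleteSpace 𝓗] in
theorem coe_inv_apply (g : domainGroup D) (x : 𝓗) :
    (g : 𝓗 ≃ₗᵢ[ℂ] 𝓗) (((g⁻¹ : domainGroup D) : 𝓗 ≃ₗᵢ[ℂ] 𝓗) x) = x :=
  (g : 𝓗 ≃ₗᵢ[ℂ] 𝓗).apply_symm_apply x

/-- The closure of `M` is a single orbit of the group generated by `𝓒`. -/
theorem exists_groupC_apply_eq (hM : IsStateManifold H₀ Hc m M)
    (hdim : ∀ ψ : D, (ψ : 𝓗) ∈ M → Module.finrank ℝ (orbitSpace (lieC H₀ Hc) ψ) = m)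
    (hBC : ∀ X ∈ lieB Hc, ∀ Y ∈ lieC H₀ Hc, ⁅X, Y⁆ ∈ lieB Hc) {x : D} (hx : (x : 𝓗) ∈ M)
    {y : 𝓗} (hy : y ∈ closure M) : ∃ g ∈ groupC F, ((dom g x : D) : 𝓗) = y := by
  obtain ⟨ρ, hρ, hball⟩ := exists_ball_orbit_groupC (F := F) hM hdim hBC hx
  have hpres : ∀ g ∈ groupC F, ∀ a ∈ closure M, (g : 𝓗 ≃ₗᵢ[ℂ] 𝓗) a ∈ closure M :=
    fun g hg a ha => groupC_mapsTo (fun Y hY => preserves_closure_manifold hM hBC hY) hg ha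
  -- The group acts by isometries of `closure M`, so the radius `ρ` obtained at `x` serves at every
  -- point of the orbit.
  have hunif : ∀ g ∈ groupC F, ∀ y ∈ closure M, ‖y - (dom g x : D)‖ < ρ →
      ∃ g' ∈ groupC F, ((dom g' x : D) : 𝓗) = y := by
    intro g hg y hy hyx
    obtain ⟨g', hg', he⟩ := hball (((g⁻¹ : domainGroup D) : 𝓗 ≃ₗᵢ[ℂ] 𝓗) y)
      (hpres _ (inv_mem hg) _ hy) (by
        rw [← LinearIsometryEquiv.norm_map (g : 𝓗 ≃ₗᵢ[ℂ] 𝓗), map_sub, coe_inv_apply]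
        exact hyx)
    refine ⟨g * g', mul_mem hg hg', ?_⟩
    rw [dom_mul_apply, coe_dom, he, coe_inv_apply]
  -- Half the radius, so that points of `closure u` are still within `ρ` of the orbit. Then `closure
  -- u ∩ M ⊆ u`, and connectedness gives `M ⊆ u`.
  set u : Set 𝓗 := {z | ∃ g ∈ groupC F, ‖z - (dom g x : D)‖ < ρ / 2} with hu
  have huo : IsOpen u := by
    have : u = ⋃ g ∈ groupC F, Metric.ball ((dom g x : D) : 𝓗) (ρ / 2) := by
      ext z; simp [hu, dist_eq_norm]
    rw [this]
    exact isOpen_biUnion fun _ _ => Metric.isOpen_ball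
  have horb : ∀ y ∈ closure M, y ∈ closure u → ∃ g ∈ groupC F, ((dom g x : D) : 𝓗) = y := by
    intro y hy hyu
    obtain ⟨z, ⟨g, hg, hz⟩, hd⟩ := Metric.mem_closure_iff.1 hyu (ρ / 2) (half_pos hρ)
    refine hunif g hg y hy ?_
    rw [dist_eq_norm] at hd
    have := norm_sub_le_norm_sub_add_norm_sub y z ((dom g x : D) : 𝓗)
    linarith
  have hMu : M ⊆ u := by
    refine hM.connected.isPreconnected.subset_of_closure_inter_subset huo
      ⟨x, hx, 1, one_mem _, by simpa using hρ⟩ ?_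
    rintro y ⟨hyu, hyM⟩
    obtain ⟨g, hg, he⟩ := horb y (subset_closure hyM) hyu
    exact ⟨g, hg, by rw [he]; simpa using hρ⟩
  exact horb y hy (closure_mono hMu hy)

/-- Backward motions preserve the closure of `M`. -/
theorem IsForward.inv_mem_closure (hM : IsStateManifold H₀ Hc m M)
    (hdim : ∀ ψ : D, (ψ : 𝓗) ∈ M → Module.finrank ℝ (orbitSpace (lieC H₀ Hc) ψ) = m)
    (hBC : ∀ X ∈ lieB Hc, ∀ Y ∈ lieC H₀ Hc, ⁅X, Y⁆ ∈ lieB Hc) {x : D} (hx : (x : 𝓗) ∈ M)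
    {T : ℝ} {w : domainGroup D} (hw : IsForward F T w) :
    ((dom w⁻¹ x : D) : 𝓗) ∈ closure M := by
  -- With `g x = w x` one has `w⁻¹ x = (w⁻¹ g⁻¹ w) x`, a motion of `x` by the normalized group.
  obtain ⟨g, hg, he⟩ := exists_groupC_apply_eq (F := F) hM hdim hBC hx
    (subset_closure (hw.mem hM hx))
  have he' : dom g x = dom w x := Subtype.ext he
  have h1 : w⁻¹ * g⁻¹ * w ∈ groupC F := hw.conj_mem_groupC (inv_mem hg)
  have h2 : dom w⁻¹ x = dom (w⁻¹ * g⁻¹ * w) x := by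
    rw [dom_mul_apply, ← he', dom_mul_apply, dom_inv_dom]
  rw [h2]
  exact groupC_mapsTo (fun Y hY => preserves_closure_manifold hM hBC hY) h1 (subset_closure hx)

theorem closure_subset_limitReach (hM : IsStateManifold H₀ Hc m M)
    (hdim : ∀ ψ : D, (ψ : 𝓗) ∈ M → Module.finrank ℝ (orbitSpace (lieC H₀ Hc) ψ) = m)
    (hBC : ∀ X ∈ lieB Hc, ∀ Y ∈ lieC H₀ Hc, ⁅X, Y⁆ ∈ lieB Hc) {x : D} (hx : (x : 𝓗) ∈ M)
    {T : ℝ} (hT : 0 < T) : closure M ⊆ limitReach F T x := by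
  intro y hy
  have hx' := (isForward_drift F hT.le).mem hM hx
  obtain ⟨g, hg, rfl⟩ := exists_groupC_apply_eq (F := F) hM hdim hBC hx' hy
  exact groupC_drift_mem_limitReach hBC hT x hg

/-- From a state of `M`, every neighbourhood of every limit point of `M` is reached at every
positive time. -/
theorem exists_isForward_norm_lt (hM : IsStateManifold H₀ Hc m M)
    (hdim : ∀ ψ : D, (ψ : 𝓗) ∈ M → Module.finrank ℝ (orbitSpace (lieC H₀ Hc) ψ) = m)
    (hBC : ∀ X ∈ lieB Hc, ∀ Y ∈ lieC H₀ Hc, ⁅X, Y⁆ ∈ lieB Hc) {x : D} (hx : (x : 𝓗) ∈ M)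
    {T : ℝ} (hT : 0 < T) {y : 𝓗} (hy : y ∈ closure M) {ε : ℝ} (hε : 0 < ε) :
    ∃ w, IsForward F T w ∧ ‖((dom w x : D) : 𝓗) - y‖ < ε := by
  have hcont : ∀ᶠ s in 𝓝 (0 : ℝ), ‖(F.U (drift H₀ Hc) s : 𝓗 ≃ₗᵢ[ℂ] 𝓗) y - y‖ < ε / 2 := by
    have h1 : Tendsto (fun s => ‖(F.U (drift H₀ Hc) s : 𝓗 ≃ₗᵢ[ℂ] 𝓗) y - y‖) (𝓝 0) (𝓝 0) := by
      have h2 : Continuous fun s => ‖(F.U (drift H₀ Hc) s : 𝓗 ≃ₗᵢ[ℂ] 𝓗) y - y‖ :=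
        ((F.continuous_U _ y).sub continuous_const).norm
      simpa using h2.tendsto 0
    exact h1 (gt_mem_nhds (half_pos hε))
  obtain ⟨η, hη, hball⟩ := Metric.eventually_nhds_iff_ball.1 hcont
  -- Aiming at time `T - δ` with an overshoot below `δ` ends before `T`; the remaining time, at most
  -- `δ < η`, is filled with drift, which hardly moves `y`.
  set δ := min (η / 2) (T / 2) with hδ
  have hδ0 : 0 < δ := lt_min (half_pos hη) (half_pos hT)
  have hδη : δ ≤ η / 2 := min_le_left _ _
  have hδT : δ ≤ T / 2 := min_le_right _ _
  obtain ⟨T', w, h1, h2, h3, h4⟩ :=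
    closure_subset_limitReach (F := F) hM hdim hBC hx (T := T - δ) (by linarith) hy
      (min δ (ε / 2)) (lt_min hδ0 (half_pos hε))
  have hT' : T' < T := by linarith [min_le_left δ (ε / 2)]
  have hd : ‖((dom w x : D) : 𝓗) - y‖ < ε / 2 := h4.trans_le (min_le_right _ _)
  refine ⟨F.U (drift H₀ Hc) (T - T') * w, ?_, ?_⟩
  · have := (isForward_drift F (t := T - T') (by linarith)).mul h3
    rwa [sub_add_cancel] at this
  · have hs := hball (T - T') (by
      rw [Metric.mem_ball, dist_zero_right, Real.norm_of_nonneg (by linarith)]; linarith)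
    rw [dom_mul_apply, coe_dom]
    have := norm_sub_le_norm_sub_add_norm_sub
      ((F.U (drift H₀ Hc) (T - T') : 𝓗 ≃ₗᵢ[ℂ] 𝓗) ((dom w x : D) : 𝓗))
      ((F.U (drift H₀ Hc) (T - T') : 𝓗 ≃ₗᵢ[ℂ] 𝓗) y) y
    rw [← map_sub, LinearIsometryEquiv.norm_map] at this
    linarith

end

section

variable {𝓗 : Type*} [NormedAddCommGroup 𝓗] [InnerProductSpace ℂ 𝓗] [CompleteSpace 𝓗]
variable {D : Submodule ℂ 𝓗}
variable {r : ℕ} {H₀ : Module.End ℂ D} {Hc : Fin r → Module.End ℂ D}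
variable {F : AnalyticFlow (lieL H₀ Hc)} {m : ℕ} {M : Set 𝓗}

/-! ### Backward motions in an exact time -/

theorem IsForward.Ad_mem_lieL {T : ℝ} {w : domainGroup D} (hw : IsForward F T w)
    {Y : Module.End ℂ D} (hY : Y ∈ lieL H₀ Hc) : Ad w Y ∈ lieL H₀ Hc := by
  induction hw with
  | one => simpa using hY
  | step c ht h ih => rw [Ad_mul]; exact F.Ad_U_mem_L _ _ ih

theorem IsForward.Ad_inv_mem_lieC {T : ℝ} {w : domainGroup D} (hw : IsForward F T w)
    {Y : Module.End ℂ D} (hY : Y ∈ lieC H₀ Hc) : Ad w⁻¹ Y ∈ lieC H₀ Hc := by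
  induction hw generalizing Y with
  | one => simpa using hY
  | step c ht h ih =>
    rw [mul_inv_rev, Ad_mul, ← F.U_neg]
    exact ih (Ad_U_mem_lieC _ hY)

variable (F) in
/-- The forward motion `w` of duration `τ` ends in `χ` and can be varied, keeping the duration and
the final state, such that the initial state moves in all directions `w⁻¹ Y χ` with `Y ∈ W`. -/
def HasExactFamily (χ : D) (τ : ℝ) (w : domainGroup D) (W : Submodule ℝ (Module.End ℂ D)) : Prop :=
  IsForward F τ w ∧ HasRegularFamily F (dom w⁻¹ χ)
    (fun y => ∃ w', IsForward F τ w' ∧ dom w' y = χ) ((W.map (evalAt χ)).map (realMap w⁻¹))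

omit [CompleteSpace 𝓗] in
theorem hasExactFamily_bot (χ : D) : HasExactFamily F χ 0 1 ⊥ := by
  refine ⟨IsForward.one, ?_⟩
  simp only [Submodule.map_bot]
  exact hasRegularFamily_const ⟨1, IsForward.one, by simp⟩

omit [CompleteSpace 𝓗] in
theorem map_realMap_mul (g h : domainGroup D) (W : Submodule ℝ 𝓗) :
    (W.map (realMap h)).map (realMap g) = W.map (realMap (g * h)) := by
  rw [← Submodule.map_comp]
  rfl

/-- The new segment comes earlier in time than `w`, so it only pulls the initial states back; the
directions `W`, read at the final state `χ`, are unchanged. -/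
theorem HasExactFamily.mul_U {χ : D} {τ : ℝ} {w : domainGroup D}
    {W : Submodule ℝ (Module.End ℂ D)} (h : HasExactFamily F χ τ w W) (c : Fin r → ℝ) {t : ℝ}
    (ht : 0 ≤ t) : HasExactFamily F χ (τ + t) (w * F.U (controlled H₀ Hc c) t) W := by
  obtain ⟨h1, h2⟩ := h
  set X := controlled H₀ Hc c with hX
  refine ⟨h1.mul (isForward_U F c ht), ?_⟩
  have h3 := h2.flow_flow (P' := fun y => ∃ w', IsForward F (τ + t) w' ∧ dom w' y = χ) X X (-t) 0 0 0
    (Eventually.of_forall fun a y hy => by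
      obtain ⟨w', hw', he⟩ := hy
      refine ⟨w' * F.U X t, hw'.mul (isForward_U F c ht), ?_⟩
      simp only [zero_mul, add_zero, AnalyticFlow.U_zero, map_one, Module.End.one_apply, F.U_neg]
      rw [dom_mul_apply, dom_dom_inv, he])
  have hbase : dom (F.U X 0) (dom (F.U X (-t)) (dom w⁻¹ χ)) = dom (w * F.U X t)⁻¹ χ := by
    simp only [AnalyticFlow.U_zero, map_one, Module.End.one_apply, F.U_neg, mul_inv_rev,
      dom_mul_apply]
  rw [hbase, map_realMap_mul] at h3
  refine h3.mono ?_
  simp only [AnalyticFlow.U_zero, one_mul, F.U_neg, mul_inv_rev]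
  exact le_sup_left

theorem HasExactFamily.mul {χ : D} {τ : ℝ} {w : domainGroup D}
    {W : Submodule ℝ (Module.End ℂ D)} (h : HasExactFamily F χ τ w W) {σ : ℝ} {w' : domainGroup D}
    (hw' : IsForward F σ w') : HasExactFamily F χ (τ + σ) (w * w') W := by
  induction hw' generalizing τ w with
  | one => simpa using h
  | @step T v c t ht hv ih =>
    have := ih (h.mul_U c ht)
    rwa [mul_assoc, show τ + t + T = τ + (T + t) by ring] at this

/-- Exchanging time between two successive controls. -/
theorem HasExactFamily.exchange {χ : D} {τ : ℝ} {w : domainGroup D}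
    {W : Submodule ℝ (Module.End ℂ D)} (h : HasExactFamily F χ τ w W) (c c' : Fin r → ℝ) {s s' : ℝ}
    (hs : 0 < s) (hs' : 0 < s') :
    HasExactFamily F χ (τ + (s + s'))
      (w * (F.U (controlled H₀ Hc c) s * F.U (controlled H₀ Hc c') s'))
      (W ⊔ Submodule.span ℝ {Ad (w * F.U (controlled H₀ Hc c) s)
        ((controlled H₀ Hc c' : Module.End ℂ D) - (controlled H₀ Hc c : Module.End ℂ D))}) := by
  obtain ⟨h1, h2⟩ := h
  set X := controlled H₀ Hc c with hX
  set X' := controlled H₀ Hc c' with hX'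
  refine ⟨h1.mul ((isForward_U F c hs.le).mul (isForward_U F c' hs'.le)), ?_⟩
  -- Both durations `s + a` and `s' - a` must stay nonnegative; their sum does not depend on `a`.
  have hev : ∀ᶠ a in 𝓝 (0 : ℝ), -s < a ∧ a < s' :=
    (lt_mem_nhds (neg_lt_zero.2 hs)).and (gt_mem_nhds hs')
  have h3 := h2.flow_flow (P' := fun y => ∃ w', IsForward F (τ + (s + s')) w' ∧ dom w' y = χ)
    X X' (-s) (-s') (-1) 1 (by
      filter_upwards [hev] with a ha y hy
      obtain ⟨v, hv, he⟩ := hy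
      refine ⟨v * (F.U X (s + a) * F.U X' (s' - a)), ?_, ?_⟩
      · have := hv.mul ((isForward_U F c (t := s + a) (by linarith)).mul
          (isForward_U F c' (t := s' - a) (by linarith)))
        rwa [show s + a + (s' - a) = s + s' by ring] at this
      · rw [show -s' + 1 * a = -(s' - a) by ring, show -s + -1 * a = -(s + a) by ring, F.U_neg,
          F.U_neg, dom_mul_apply, dom_mul_apply, dom_dom_inv, dom_dom_inv, he])
  have hbase : dom (F.U X' (-s')) (dom (F.U X (-s)) (dom w⁻¹ χ)) =
      dom (w * (F.U X s * F.U X' s'))⁻¹ χ := by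
    simp only [F.U_neg, mul_inv_rev, dom_mul_apply]
  rw [map_realMap_mul] at h3
  have hg : F.U X' (-s') * F.U X (-s) * w⁻¹ = (w * (F.U X s * F.U X' s'))⁻¹ := by
    simp only [F.U_neg, mul_inv_rev]
  rw [hg] at h3
  have hdir : (-1 : ℝ) • ((dom (F.U X' (-s')) ((X : Module.End ℂ D) (dom (F.U X (-s)) (dom w⁻¹ χ)))
        : D) : 𝓗) + (1 : ℝ) • (((X' : Module.End ℂ D)
          (dom (F.U X' (-s')) (dom (F.U X (-s)) (dom w⁻¹ χ))) : D) : 𝓗) =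
      realMap (w * (F.U X s * F.U X' s'))⁻¹
        (evalAt χ (Ad (w * F.U X s) ((X' : Module.End ℂ D) - (X : Module.End ℂ D)))) := by
    have e : dom (w * (F.U X s * F.U X' s'))⁻¹
        (Ad (w * F.U X s) ((X' : Module.End ℂ D) - (X : Module.End ℂ D)) χ) =
        dom (F.U X' (-s')) ((X' : Module.End ℂ D) (dom (F.U X (-s)) (dom w⁻¹ χ))) -
          dom (F.U X' (-s')) ((X : Module.End ℂ D) (dom (F.U X (-s)) (dom w⁻¹ χ))) := by
      rw [Ad_apply]
      simp only [F.U_neg, mul_inv_rev, dom_mul_apply, dom_inv_dom, LinearMap.sub_apply, map_sub]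
    have e' := congrArg (fun z : D => (z : 𝓗)) e
    refine Eq.trans ?_ e'.symm
    rw [F.apply_U_comm X']
    simp only [Submodule.coe_sub, neg_smul, one_smul]
    abel
  rw [hdir, hbase] at h3
  refine h3.mono ?_
  rw [Submodule.map_sup, Submodule.map_sup, Submodule.map_span, Submodule.map_span,
    Set.image_singleton, Set.image_singleton]

/-- There are motions of arbitrarily short duration that end in `χ` and can be varied in all
directions of `𝓒`. -/
theorem exists_hasExactFamily (F : AnalyticFlow (lieL H₀ Hc)) (χ : D) {T : ℝ} (hT : 0 < T) :
    ∃ τ w W, τ < T ∧ HasExactFamily F χ τ w W ∧ (lieC H₀ Hc).toSubmodule ≤ W := by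
  have hfin : FiniteDimensional ℝ (lieL H₀ Hc).toSubmodule := F.finiteDimensional
  -- A family with as many directions as possible is chosen. Any further exchange in the remaining
  -- time would enlarge `W`, so its direction already lies in `W`.
  set dims : Set ℕ := {n | ∃ τ w W, τ < T ∧ HasExactFamily F χ τ w W ∧
    W ≤ (lieL H₀ Hc).toSubmodule ∧ Module.finrank ℝ W = n} with hdims
  have hne : dims.Nonempty := ⟨0, 0, 1, ⊥, hT, hasExactFamily_bot χ, bot_le, finrank_bot _ _⟩
  have hbdd : BddAbove dims := by
    refine ⟨Module.finrank ℝ (lieL H₀ Hc).toSubmodule, ?_⟩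
    rintro n ⟨τ, w, W, -, -, hW, rfl⟩
    exact Submodule.finrank_mono hW
  obtain ⟨τ, w, W, hτ, hfam, hWL, hWdim⟩ := Nat.sSup_mem hne hbdd
  have hmax : ∀ σ w', IsForward F σ w' → ∀ c c' : Fin r → ℝ, ∀ s s' : ℝ, 0 < s → 0 < s' →
      τ + σ + (s + s') < T → Ad (w * w' * F.U (controlled H₀ Hc c) s)
        ((controlled H₀ Hc c' : Module.End ℂ D) - (controlled H₀ Hc c : Module.End ℂ D)) ∈ W := by
    intro σ w' hw' c c' s s' hs hs' hlt
    have h1 := (hfam.mul hw').exchange c c' hs hs'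
    set Z := Ad (w * w' * F.U (controlled H₀ Hc c) s)
      ((controlled H₀ Hc c' : Module.End ℂ D) - (controlled H₀ Hc c : Module.End ℂ D)) with hZ
    have hZL : Z ∈ lieL H₀ Hc :=
      ((hfam.1.mul hw').mul (isForward_U F c hs.le)).Ad_mem_lieL
        (sub_mem (controlled H₀ Hc c').2 (controlled H₀ Hc c).2)
    have h2 : W ⊔ Submodule.span ℝ {Z} ≤ (lieL H₀ Hc).toSubmodule :=
      sup_le hWL ((Submodule.span_singleton_le_iff_mem _ _).2 hZL)
    have : FiniteDimensional ℝ ↥(W ⊔ Submodule.span ℝ {Z}) := Submodule.finiteDimensional_of_le h2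
    have h3 : Module.finrank ℝ ↥(W ⊔ Submodule.span ℝ {Z}) ≤ Module.finrank ℝ W := by
      rw [hWdim]
      exact le_csSup hbdd ⟨_, _, _, hlt, h1, h2, rfl⟩
    have h4 := Submodule.eq_of_le_of_finrank_le (le_sup_left : W ≤ W ⊔ Submodule.span ℝ {Z}) h3
    rw [h4]
    exact Submodule.mem_sup_right (Submodule.mem_span_singleton_self Z)
  -- As forward motions `w'` may be lengthened by any constant control, differentiation shows that
  -- `S` is stable under `ad (H₀ + ∑ c_l H_l)` for every `c`, hence under `ad H₀` and each `ad H_l`.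
  let S : Submodule ℝ (Module.End ℂ D) :=
    { carrier := {Y | Y ∈ lieL H₀ Hc ∧ ∃ η > 0, ∀ σ w', σ < η → IsForward F σ w' → Ad (w * w') Y ∈ W}
      add_mem' := by
        rintro Y Z ⟨hY, η, hη, h⟩ ⟨hZ, η', hη', h'⟩
        refine ⟨add_mem hY hZ, min η η', lt_min hη hη', fun σ w' hσ hw' => ?_⟩
        rw [map_add]
        exact W.add_mem (h σ w' (hσ.trans_le (min_le_left _ _)) hw')
          (h' σ w' (hσ.trans_le (min_le_right _ _)) hw')
      zero_mem' := ⟨zero_mem _, 1, one_pos, fun σ w' _ _ => by rw [map_zero]; exact W.zero_mem⟩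
      smul_mem' := by
        rintro c Y ⟨hY, η, hη, h⟩
        refine ⟨(lieL H₀ Hc).smul_mem c hY, η, hη, fun σ w' hσ hw' => ?_⟩
        rw [map_smul]
        exact W.smul_mem c (h σ w' hσ hw') }
  have hlie : ∀ c : Fin r → ℝ, ∀ Y ∈ S, ⁅(controlled H₀ Hc c : Module.End ℂ D), Y⁆ ∈ S := by
    rintro c Y ⟨hY, η, hη, h⟩
    refine (F.mem_and_lie_mem_of_Ad_mem (controlled H₀ Hc c) hY ?_).2
    filter_upwards [Ioo_mem_nhdsGT hη] with t ht
    refine ⟨F.Ad_U_mem_L _ _ hY, η - t, sub_pos.2 ht.2, fun σ w' hσ hw' => ?_⟩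
    rw [← Ad_mul, mul_assoc]
    exact h (σ + t) _ (by linarith) (hw'.mul (isForward_U F c ht.1.le))
  have hc0 : (controlled H₀ Hc 0 : Module.End ℂ D) = H₀ := by simp [controlled]
  have hcl : ∀ l, (controlled H₀ Hc (Pi.single l 1) : Module.End ℂ D) = H₀ + Hc l := by
    intro l
    have : ∑ k, (Pi.single l 1 : Fin r → ℝ) k • Hc k = Hc l := by
      rw [Finset.sum_eq_single l]
      · simp
      · intro k _ hk; simp [hk]
      · simp
    simp [controlled, this]
  have hlie0 : ∀ Y ∈ S, ⁅H₀, Y⁆ ∈ S := by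
    intro Y hY
    rw [← hc0]
    exact hlie 0 Y hY
  have hliec : ∀ l, ∀ Y ∈ S, ⁅Hc l, Y⁆ ∈ S := by
    intro l Y hY
    have h1 := hlie (Pi.single l 1) Y hY
    rw [hcl, add_lie] at h1
    simpa using S.sub_mem h1 (hlie0 Y hY)
  have hctrl : ∀ l, Hc l ∈ S := by
    intro l
    refine ⟨control_mem_lieL H₀ Hc l, T - τ, sub_pos.2 hτ, fun σ w' hσ hw' => ?_⟩
    -- Exchanging between the controls 0 and `e_l` gives the generator difference `H_l`, transported
    -- by a drift of duration `s`; the limit `s → 0` removes the drift.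
    refine (F.mem_and_lie_mem_of_Ad_mem (controlled H₀ Hc 0) (S := W.comap (Ad (w * w')))
      (control_mem_lieL H₀ Hc l) ?_).1
    have hpos : 0 < (T - τ - σ) / 2 := by linarith
    filter_upwards [Ioo_mem_nhdsGT hpos] with s hs
    have := hmax σ w' hw' 0 (Pi.single l 1) s ((T - τ - σ) / 2) hs.1 hpos (by linarith [hs.2])
    rw [hcl, hc0, add_sub_cancel_left, Ad_mul] at this
    exact this
  let K : LieSubalgebra ℝ (Module.End ℂ D) :=
    { S with lie_mem' := fun {X Y} hX hY => lie_mem_of_generators hlie0 hliec hX.1 hY }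
  have hBK : lieB Hc ≤ K := by
    refine LieSubalgebra.lieSpan_le.2 ?_
    rintro X ⟨l, rfl⟩
    exact hctrl l
  have hCK : lieC H₀ Hc ≤ K :=
    lieC_le fun n X hX => ad_pow_mem_of_stable (S := S) (fun Y hY => hBK hY) hlie0 n hX
  refine ⟨τ, w, W, hτ, hfam, fun Y hY => ?_⟩
  -- `Ad w⁻¹` maps `𝓒` into itself, so membership in `S` for `w' = 1` returns `Y = Ad w (Ad w⁻¹ Y) ∈
  -- W`.
  obtain ⟨-, η, hη, h⟩ := hCK (hfam.1.Ad_inv_mem_lieC hY)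
  simpa using h 0 1 hη IsForward.one

/-! ### Exact steering between two states -/

omit [CompleteSpace 𝓗] in
theorem IsForward.mem_closure (hM : IsStateManifold H₀ Hc m M) {T : ℝ} {w : domainGroup D}
    (hw : IsForward F T w) {y : 𝓗} (hy : y ∈ closure M) :
    (w : 𝓗 ≃ₗᵢ[ℂ] 𝓗) y ∈ closure M := by
  have h1 : Set.MapsTo (w : 𝓗 ≃ₗᵢ[ℂ] 𝓗) (M ∩ D) M := fun x hx =>
    hw.mem hM (x := ⟨x, hx.2⟩) hx.1
  exact h1.closure (LinearIsometryEquiv.continuous _)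
    (closure_minimal hM.dense isClosed_closure hy)

/-- The last stretch `τ` corrects the error of the first: `ψ` is brought near `w⁻¹ χ` in time `T -
τ`, and every state there whose image under `w` lies in `closure M` near `χ` can be steered to `χ`
in time exactly `τ`. -/
theorem exists_isForward_apply_eq (F : AnalyticFlow (lieL H₀ Hc)) (hM : IsStateManifold H₀ Hc m M)
    (hdim : ∀ ψ : D, (ψ : 𝓗) ∈ M → Module.finrank ℝ (orbitSpace (lieC H₀ Hc) ψ) = m)
    (hBC : ∀ X ∈ lieB Hc, ∀ Y ∈ lieC H₀ Hc, ⁅X, Y⁆ ∈ lieB Hc) {ψ χ : D} (hψ : (ψ : 𝓗) ∈ M)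
    (hχ : (χ : 𝓗) ∈ M) {T : ℝ} (hT : 0 < T) : ∃ w, IsForward F T w ∧ dom w ψ = χ := by
  obtain ⟨τ, w, W, hτ, ⟨hw, hfam⟩, hCW⟩ := exists_hasExactFamily F χ hT
  obtain ⟨ρ, hρ, hball⟩ := hfam.exists_ball hM w (dom_dom_inv w χ) hχ
    (by
      -- States that are steered to `χ` are backward images of `χ`, so they remain in `closure M`.
      rintro y ⟨w', hw', he⟩
      have hy : y = dom w'⁻¹ χ := by rw [← he, dom_inv_dom]
      rw [hy]
      exact hw.mem_closure hM (hw'.inv_mem_closure hM hdim hBC hχ))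
    (by
      rw [orbitSpace_lieL_eq hM hdim hχ, map_realMap_mul, mul_inv_cancel]
      intro z hz
      exact ⟨z, Submodule.map_mono hCW hz, by simp⟩)
  obtain ⟨v, hv, hvn⟩ := exists_isForward_norm_lt (F := F) hM hdim hBC hψ (sub_pos.2 hτ)
    (hw.inv_mem_closure hM hdim hBC hχ) hρ
  have hclose : ‖((dom w (dom v ψ) : D) : 𝓗) - χ‖ < ρ := by
    have e : (χ : 𝓗) = (w : 𝓗 ≃ₗᵢ[ℂ] 𝓗) ((dom w⁻¹ χ : D) : 𝓗) := by
      rw [← coe_dom, dom_dom_inv]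
    rw [e, coe_dom, ← map_sub, LinearIsometryEquiv.norm_map]
    exact hvn
  obtain ⟨z, ⟨w', hw', he⟩, hz⟩ :=
    hball _ (subset_closure (hw.mem hM (hv.mem hM hψ))) hclose
  have hz' : z = dom v ψ := by
    have h1 := congrArg (dom w⁻¹) (Subtype.ext hz : dom w z = dom w (dom v ψ))
    simpa using h1
  refine ⟨w' * v, ?_, by rw [dom_mul_apply, ← hz', he]⟩
  have := hw'.mul hv
  rwa [add_sub_cancel] at this

end

end QuantumControl

end

theorem corollary4p8 {𝓗 : Type*} [NormedAddCommGroup 𝓗] [InnerProductSpace ℂ 𝓗]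
    [CompleteSpace 𝓗] (D : Submodule ℂ 𝓗) (r m : ℕ)
    (H₀ : Module.End ℂ D) (Hc : Fin r → Module.End ℂ D) (M : Set 𝓗)
    (hH₀ : QuantumControl.IsSkewHermitian H₀)
    (hHc : ∀ l, QuantumControl.IsSkewHermitian (Hc l))
    (hD : QuantumControl.IsAnalyticDomain D H₀ Hc)
    (hM : QuantumControl.IsStateManifold H₀ Hc m M)
    (hdim : ∀ ψ : D, (ψ : 𝓗) ∈ M →
      Module.finrank ℝ (QuantumControl.orbitSpace (QuantumControl.lieC H₀ Hc) ψ) = m)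
    (hBC : ∀ X ∈ QuantumControl.lieB Hc, ∀ Y ∈ QuantumControl.lieC H₀ Hc,
      ⁅X, Y⁆ ∈ QuantumControl.lieB Hc) :
    QuantumControl.IsStronglyAnalyticallyControllable H₀ Hc M := by
  rintro t₀ t ht ψ ⟨hψM, hψD⟩
  refine Set.Subset.antisymm ?_ ?_
  · rintro χ ⟨u, φ, -, hφM, -, rfl⟩
    exact ⟨hφM t ⟨ht.le, le_rfl⟩, (φ t).2⟩
  · rintro χ ⟨hχM, hχD⟩
    obtain ⟨w, hw, he⟩ := QuantumControl.exists_isForward_apply_eq (hD.flow hH₀ hHc) hM hdim hBC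
      (ψ := ⟨ψ, hψD⟩) (χ := ⟨χ, hχD⟩) hψM hχM (sub_pos.2 ht)
    have h := hw.mem_reachableSet hM t₀ (x := ⟨ψ, hψD⟩) hψM
    rw [he, add_sub_cancel] at h
    exact h
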